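/- Let $\Gamma$ be a finite simple $3$-connected planar graph, that is, $\Gamma$ has at least four vertices, it stays connected after the removal of any at most two vertices, and it can be topologically embedded in the oriented sphere $S^2=\mathbb{CP}^1$. Fix a ribbon structure on $\Gamma$, that is, a cyclic order on the half-edges incident to each vertex. A topological embedding $em:\Gamma\hookrightarrow\mathbb{CP}^1$ induces a second cyclic order at each vertex, namely the counterclockwise order in which the half-edges leave the vertex in the oriented sphere. The defect $\operatorname{def}(\Gamma,em)$ is the number of vertices at which the prescribed and the induced cyclic orders differ. Let $em_0$ be any embedding of $\Gamma$ in $\mathbb{CP}^1$ and let $\overline{em_0}$ be its mirror image, that is, its composition with an orientation-reversing reflection of the sphere. Put $\delta_+(\Gamma)=\operatorname{def}(\Gamma,em_0)$ and $\delta_-(\Gamma)=\operatorname{def}(\Gamma,\overline{em_0})$. Then \[ \min_{em}\operatorname{def}(\Gamma,em)=\min\{\delta_+(\Gamma),\delta_-(\Gamma)\}, \] where the minimum on the left is over all topological embeddings $em:\Gamma\hookrightarrow\mathbb{CP}^1$ and is attained. -/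

import Mathlib

open Set Filter Topology

/-- `G` is `k`-connected: it is finite with more than `k` vertices, and it stays connected after
the removal of any set of fewer than `k` vertices. -/
def SimpleGraph.IsVertexConnected {V : Type*} (G : SimpleGraph V) (k : ℕ) : Prop :=
  Finite V ∧ k < Nat.card V ∧ ∀ S : Set V, S.ncard < k → (G.induce Sᶜ).Connected

/-- A ribbon structure on `G`: a cyclic order on the half-edges at each vertex. As `G` is simple,
the half-edges at `v` are in bijection with the neighbours of `v`. -/
def RibbonStructure {V : Type*} (G : SimpleGraph V) : Type _ :=
  ∀ v : V, CircularOrder (G.neighborSet v)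

/-- Euclidean 3-space. -/
abbrev E3 : Type := EuclideanSpace ℝ (Fin 3)

/-- The Riemann sphere, as the unit sphere of Euclidean 3-space. It is oriented by its outer
normal, and the distance on it is the chordal one. -/
abbrev S2 : Type := Metric.sphere (0 : E3) 1

/-- A topological embedding of (the geometric realization of) `G` into the sphere: vertices go to
distinct points, edges to simple arcs joining the images of their ends, an arc meets vertices only
at its ends, and arcs of distinct edges are disjoint apart from their ends. Each edge is
parametrized in both directions, and the two parametrizations are reverses of each other. For a
finite graph such a continuous injection is a homeomorphism onto its image. -/
structure SphereEmbedding {V : Type*} (G : SimpleGraph V) where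
  vert : V → S2
  arc : ∀ {v w : V}, G.Adj v w → Path (vert v) (vert w)
  vert_injective : Function.Injective vert
  arc_symm : ∀ {v w : V} (h : G.Adj v w), arc h.symm = (arc h).symm
  arc_injective : ∀ {v w : V} (h : G.Adj v w), Function.Injective (arc h)
  arc_ne_vert : ∀ {v w : V} (h : G.Adj v w) (t : unitInterval) (u : V),
    arc h t = vert u → t = 0 ∨ t = 1
  arc_disjoint : ∀ {v w x y : V} (h : G.Adj v w) (h' : G.Adj x y) (s t : unitInterval),
    s ≠ 0 → s ≠ 1 → arc h s = arc h' t → s(v, w) = s(x, y)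

/-- For `p`, `q`, `r` on a common circle on the sphere centred at `c`: they are distinct and are
met in this order when the circle is run through counterclockwise around `c`, as seen from outside
the sphere. -/
def IsCounterclockwise (c p q r : S2) : Prop :=
  0 < Matrix.det !![c.1 0, c.1 1, c.1 2;
    q.1 0 - p.1 0, q.1 1 - p.1 1, q.1 2 - p.1 2;
    r.1 0 - p.1 0, r.1 1 - p.1 1, r.1 2 - p.1 2]

/-- `p` is the first point at which the path `γ` meets the circle of radius `ρ` around the
starting point `a` of `γ`. -/
def IsFirstHit {a b : S2} (γ : Path a b) (ρ : ℝ) (p : S2) : Prop :=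
  ∃ t : unitInterval, γ t = p ∧ dist p a = ρ ∧ ∀ s < t, dist (γ s) a < ρ

namespace SphereEmbedding

variable {V : Type*} {G : SimpleGraph V}

/-- The cyclic order induced by an embedding at `v`: the half-edges from `v` to `a`, `b`, `c` leave
`v` in this counterclockwise order. That is, on every sufficiently small circle around `v`, the
points at which the three arcs first reach the circle lie in this counterclockwise order. -/
def InducedOrder (em : SphereEmbedding G) (v : V) (a b c : G.neighborSet v) : Prop :=
  ∀ᶠ ρ : ℝ in 𝓝[>] 0, ∃ p q r : S2,
    IsFirstHit (em.arc a.2) ρ p ∧ IsFirstHit (em.arc b.2) ρ q ∧ IsFirstHit (em.arc c.2) ρ r ∧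
      IsCounterclockwise (em.vert v) p q r

end SphereEmbedding

/-- The prescribed cyclic order at `v` is the one induced by the embedding. -/
def RibbonStructure.AgreesAt {V : Type*} {G : SimpleGraph V} (R : RibbonStructure G)
    (em : SphereEmbedding G) (v : V) : Prop :=
  letI := R v
  ∀ a b c : G.neighborSet v, sbtw a b c ↔ em.InducedOrder v a b c

/-- The defect of an embedding: the number of vertices at which the prescribed cyclic order
differs from the one induced by the embedding. -/
noncomputable def RibbonStructure.defect {V : Type*} {G : SimpleGraph V} (R : RibbonStructure G)
    (em : SphereEmbedding G) : ℕ :=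
  {v : V | ¬ R.AgreesAt em v}.ncard

/-- The orientation reversing reflection `(x, y, z) ↦ (x, -y, z)` of the sphere. In the orientation
preserving stereographic coordinate `(x + i y) / (1 + z)` it is complex conjugation. -/
noncomputable def S2.reflect (p : S2) : S2 :=
  ⟨!₂[p.1 0, -p.1 1, p.1 2], by
    have h := p.2
    simp only [mem_sphere_iff_norm, sub_zero, EuclideanSpace.norm_eq, Fin.sum_univ_three] at h ⊢
    simpa using h⟩

theorem S2.reflect_reflect (p : S2) : S2.reflect (S2.reflect p) = p := by
  apply Subtype.ext
  ext i
  fin_cases i <;> simp [S2.reflect]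

theorem S2.reflect_injective : Function.Injective S2.reflect :=
  Function.LeftInverse.injective S2.reflect_reflect

theorem S2.continuous_reflect : Continuous S2.reflect := by
  refine Continuous.subtype_mk ?_ _
  refine (PiLp.continuous_toLp 2 _).comp (continuous_pi fun i => ?_)
  fin_cases i <;> simp <;> fun_prop

/-- The mirror image of an embedding: its composition with the reflection of the sphere. -/
noncomputable def SphereEmbedding.mirror {V : Type*} {G : SimpleGraph V} (em : SphereEmbedding G) :
    SphereEmbedding G where
  vert v := S2.reflect (em.vert v)
  arc h := (em.arc h).map S2.continuous_reflect
  vert_injective := S2.reflect_injective.comp em.vert_injective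
  arc_symm h := by rw [em.arc_symm, Path.map_symm]
  arc_injective h := S2.reflect_injective.comp (em.arc_injective h)
  arc_ne_vert h t u hu := em.arc_ne_vert h t u (S2.reflect_injective hu)
  arc_disjoint h h' s t h0 h1 hs := em.arc_disjoint h h' s t h0 h1 (S2.reflect_injective hs)

/-! This is Whitney's uniqueness theorem in terms of rotations. For a 3-connected graph the induced
cyclic orders of any embedding are those of `em₀` at every vertex, or those of its mirror image at
every vertex (`SphereEmbedding.inducedOrder_iff_or`). The defect depends only on the induced orders,
so it takes at most the two values in the minimum, and both occur.

The topological input is `leaveCounterclockwise_theta`: three arcs joining `p` to `q` and otherwise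
disjoint leave `q` in the order opposite to the one at `p`. Neither faces nor the Jordan curve
theorem are used. The sphere minus `p` and `q` is an open cylinder. The arcs are lifted to its
universal cover, a strip with a height and an angle, and `IsHeightProfile.endHit_order` shows by a
continuous logarithm that two disjoint lifts have the same left-right order at both ends. The arcs
may be wild: height need not be monotone and the angle may diverge at the poles, so orders are
compared only at first or last hits of a level.

The combinatorial input is that thetas connect all tripods (a vertex with three distinct
neighbours). A symmetric property of tripods shared by the two branch points of each theta subgraph
holds for all tripods or for none (`IsThetaInvariant.iff_of_isTripod`). At one vertex, legs are
exchanged one at a time using disjoint walks from Menger's theorem; across an edge one passes by a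
theta whose branch points are its ends. The property "the two embeddings order this tripod alike" is
of this kind, since both orders reverse along a theta. So the embeddings agree on all tripods or on
none, and in the latter case one agrees with the mirror image of the other. -/

/-- A function taking integer values on a set, and congruent to a continuous function there, is
constant on preconnected subsets. -/
theorem IsPreconnected.int_eq_of_continuousOn {X : Type*} [TopologicalSpace X] {S : Set X}
    (hS : IsPreconnected S) {k : X → ℤ} (hk : ContinuousOn (fun x => (k x : ℝ)) S) {x y : X}
    (hx : x ∈ S) (hy : y ∈ S) : k x = k y := by
  have hk' : ContinuousOn k S := by
    rw [Int.isClosedEmbedding_coe_real.isInducing.continuousOn_iff]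
    exact hk
  exact hS.constant hk' hx hy

theorem Convex.isSimplyConnected {E : Type*} [NormedAddCommGroup E] [NormedSpace ℝ E] {S : Set E}
    (hS : Convex ℝ S) (hne : S.Nonempty) : IsSimplyConnected S := by
  have := hS.contractibleSpace hne
  exact SimplyConnectedSpace.ofContractible S

/-! ### Order of disjoint curves crossing a strip -/

/-- A height profile: a continuous function on the unit interval which runs from `-1` to `1` and
lies strictly in between at interior parameters. -/
structure IsHeightProfile (h : ℝ → ℝ) : Prop where
  continuousOn : ContinuousOn h (Icc 0 1)
  zero : h 0 = -1
  one : h 1 = 1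
  lower : ∀ t ∈ Ioo (0 : ℝ) 1, -1 < h t
  upper : ∀ t ∈ Ioo (0 : ℝ) 1, h t < 1

theorem IsHeightProfile.eventually_lt {h : ℝ → ℝ} (hh : IsHeightProfile h) {c : ℝ} (hc : -1 < c) :
    ∀ᶠ s in 𝓝[>] (0 : ℝ), h s < c := by
  have h1 := (hh.continuousOn 0 (by simp)).tendsto
  rw [hh.zero] at h1
  have h2 := h1.eventually (gt_mem_nhds hc)
  have h3 : 𝓝[>] (0 : ℝ) ≤ 𝓝[Icc 0 1] 0 := by
    rw [← nhdsWithin_Ioo_eq_nhdsGT (zero_lt_one' ℝ)]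
    exact nhdsWithin_mono _ Ioo_subset_Icc_self
  exact h3 h2

theorem IsHeightProfile.eventually_gt {h : ℝ → ℝ} (hh : IsHeightProfile h) {c : ℝ} (hc : c < 1) :
    ∀ᶠ s in 𝓝[<] (1 : ℝ), c < h s := by
  have h1 := (hh.continuousOn 1 (by simp)).tendsto
  rw [hh.one] at h1
  have h2 := h1.eventually (lt_mem_nhds hc)
  have h3 : 𝓝[<] (1 : ℝ) ≤ 𝓝[Icc 0 1] 1 := by
    rw [← nhdsWithin_Ioo_eq_nhdsLT (zero_lt_one' ℝ)]
    exact nhdsWithin_mono _ Ioo_subset_Icc_self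
  exact h3 h2

/-- An integer-valued function which is locally constant on the region `hf ≤ hg` takes the same
value at every point of first or last contact as near the corner `(0, 1)`. -/
theorem IsHeightProfile.eventually_eq_corner {hf hg : ℝ → ℝ} (Hf : IsHeightProfile hf)
    (Hg : IsHeightProfile hg) {k : ℝ × ℝ → ℤ}
    (hk : ContinuousOn (fun x => (k x : ℝ)) {x ∈ Ioo 0 1 ×ˢ Ioo 0 1 | hf x.1 ≤ hg x.2})
    {s₀ t₀ : ℝ} (hs₀ : s₀ ∈ Ioo (0 : ℝ) 1) (ht₀ : t₀ ∈ Ioo (0 : ℝ) 1) (h : hf s₀ = hg t₀)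
    (hit : (∀ s ∈ Ioo 0 s₀, hf s < hf s₀) ∨ ∀ t ∈ Ioo t₀ 1, hg t₀ < hg t) :
    ∀ᶠ t in 𝓝[<] (1 : ℝ), ∀ᶠ s in 𝓝[>] (0 : ℝ), k (s₀, t₀) = k (s, t) := by
  set A := {x ∈ Ioo (0 : ℝ) 1 ×ˢ Ioo (0 : ℝ) 1 | hf x.1 ≤ hg x.2} with hA
  have hor : ∀ s s' t : ℝ, s ≤ s' → (∀ r ∈ Icc s s', (r, t) ∈ A) → k (s', t) = k (s, t) := by
    intro s s' t hss hr
    have hsub : (fun r => (r, t)) '' Icc s s' ⊆ A := by rintro _ ⟨r, hr', rfl⟩; exact hr r hr'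
    exact (isPreconnected_Icc.image (fun r : ℝ => (r, t)) (by fun_prop)).int_eq_of_continuousOn
      (hk.mono hsub) ⟨s', ⟨hss, le_rfl⟩, rfl⟩ ⟨s, ⟨le_rfl, hss⟩, rfl⟩
  have ver : ∀ s t t' : ℝ, t ≤ t' → (∀ r ∈ Icc t t', (s, r) ∈ A) → k (s, t) = k (s, t') := by
    intro s t t' htt hr
    have hsub : (fun r => (s, r)) '' Icc t t' ⊆ A := by rintro _ ⟨r, hr', rfl⟩; exact hr r hr'
    exact (isPreconnected_Icc.image (fun r : ℝ => (s, r)) (by fun_prop)).int_eq_of_continuousOn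
      (hk.mono hsub) ⟨t, ⟨le_rfl, htt⟩, rfl⟩ ⟨t', ⟨htt, le_rfl⟩, rfl⟩
  -- At a first hit, decreasing `s` keeps `hf` below `hg t₀`; once `hf s` is below the minimum of
  -- `hg` on `[t₀, t]`, the second parameter can be raised. At a last hit the two moves are made in
  -- the other order.
  rcases hit with hit | hit
  · filter_upwards [Ioo_mem_nhdsLT ht₀.2] with t ht
    obtain ⟨r, hr, hmin⟩ := isCompact_Icc.exists_isMinOn (nonempty_Icc.2 ht.1.le)
      (Hg.continuousOn.mono (Icc_subset_Icc ht₀.1.le ht.2.le))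
    have hr' : -1 < hg r := Hg.lower r ⟨ht₀.1.trans_le hr.1, hr.2.trans_lt ht.2⟩
    filter_upwards [Ioo_mem_nhdsGT hs₀.1, Hf.eventually_lt hr'] with s hs hlt
    rw [hor s s₀ t₀ hs.2.le, ver s t₀ t ht.1.le]
    · intro x hx
      exact ⟨⟨⟨hs.1, hs.2.trans hs₀.2⟩, ht₀.1.trans_le hx.1, hx.2.trans_lt ht.2⟩,
        hlt.le.trans (hmin hx)⟩
    · intro x hx
      refine ⟨⟨⟨hs.1.trans_le hx.1, hx.2.trans_lt hs₀.2⟩, ht₀⟩, ?_⟩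
      rcases hx.2.eq_or_lt with rfl | hlt'
      · exact h.le
      · exact (hit x ⟨hs.1.trans_le hx.1, hlt'⟩).le.trans h.le
  · obtain ⟨r, hr, hmax⟩ := isCompact_Icc.exists_isMaxOn (nonempty_Icc.2 hs₀.1.le)
      (Hf.continuousOn.mono (Icc_subset_Icc le_rfl hs₀.2.le))
    have hr' : hf r < 1 := by
      rcases hr.1.eq_or_lt with rfl | h0
      · rw [Hf.zero]; norm_num
      · exact Hf.upper r ⟨h0, hr.2.trans_lt hs₀.2⟩
    filter_upwards [Ioo_mem_nhdsLT ht₀.2, Hg.eventually_gt hr'] with t ht hlt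
    filter_upwards [Ioo_mem_nhdsGT hs₀.1] with s hs
    rw [ver s₀ t₀ t ht.1.le, hor s s₀ t hs.2.le]
    · intro x hx
      exact ⟨⟨⟨hs.1.trans_le hx.1, hx.2.trans_lt hs₀.2⟩, ht₀.1.trans ht.1, ht.2⟩,
        (hmax ⟨hs.1.le.trans hx.1, hx.2⟩).trans hlt.le⟩
    · intro x hx
      refine ⟨⟨hs₀, ht₀.1.trans_le hx.1, hx.2.trans_lt ht.2⟩, ?_⟩
      rcases hx.1.eq_or_lt with rfl | hlt'
      · exact h.le
      · exact h.le.trans (hit x ⟨hlt', hx.2.trans_lt ht.2⟩).le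

/-- Two height profiles reach a common level for the first time, or for the last time. -/
def IsEndHit (hf hg : ℝ → ℝ) (s t : ℝ) : Prop :=
  s ∈ Ioo (0 : ℝ) 1 ∧ t ∈ Ioo (0 : ℝ) 1 ∧ hf s = hg t ∧
    (((∀ r ∈ Ioo 0 s, hf r < hf s) ∧ ∀ r ∈ Ioo 0 t, hg r < hg t) ∨
      ((∀ r ∈ Ioo s 1, hf s < hf r) ∧ ∀ r ∈ Ioo t 1, hg t < hg r))

/-- Curves which cross a strip without meeting cross it in the same order at both ends. -/
theorem IsHeightProfile.endHit_order {hf hg θf θg : ℝ → ℝ} (Hf : IsHeightProfile hf)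
    (Hg : IsHeightProfile hg) (cf : ContinuousOn θf (Ioo 0 1)) (cg : ContinuousOn θg (Ioo 0 1))
    (hne : ∀ s ∈ Ioo (0 : ℝ) 1, ∀ t ∈ Ioo (0 : ℝ) 1, hf s = hg t → θf s ≠ θg t)
    {s t s' t' : ℝ} (h : IsEndHit hf hg s t) (h' : IsEndHit hf hg s' t')
    (hlt : θf s < θg t) : θf s' < θg t' := by
  set U : Set (ℝ × ℝ) := Ioo (0 : ℝ) 1 ×ˢ Ioo (0 : ℝ) 1 with hU
  -- The difference of the two curves in the strip. It has no zero because they do not meet, so it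
  -- has a continuous logarithm on the open square.
  set Φ : ℝ × ℝ → ℂ := fun x => ⟨hf x.1 - hg x.2, θf x.1 - θg x.2⟩ with hΦ
  have m1 : MapsTo Prod.fst U (Ioo (0 : ℝ) 1) := fun x hx => hx.1
  have m2 : MapsTo Prod.snd U (Ioo (0 : ℝ) 1) := fun x hx => hx.2
  have hfc := Hf.continuousOn.mono Ioo_subset_Icc_self
  have hgc := Hg.continuousOn.mono Ioo_subset_Icc_self
  have cΦ : ContinuousOn Φ U := by
    have h1 : ContinuousOn (fun x : ℝ × ℝ => hf x.1 - hg x.2) U :=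
      (hfc.comp continuousOn_fst m1).sub (hgc.comp continuousOn_snd m2)
    have h2 : ContinuousOn (fun x : ℝ × ℝ => θf x.1 - θg x.2) U :=
      (cf.comp continuousOn_fst m1).sub (cg.comp continuousOn_snd m2)
    exact Complex.equivRealProdCLM.symm.continuous.comp_continuousOn (h1.prodMk h2)
  have hΦ0 : ∀ x ∈ U, Φ x ≠ 0 := by
    intro x hx h0
    have h1 := congrArg Complex.re h0
    have h2 := congrArg Complex.im h0
    simp only [hΦ, Complex.zero_re, Complex.zero_im] at h1 h2
    exact hne _ hx.1 _ hx.2 (by linarith) (by linarith)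
  have hUconv : Convex ℝ U := (convex_Ioo 0 1).prod (convex_Ioo 0 1)
  have hUsc : IsSimplyConnected U := hUconv.isSimplyConnected ⟨(1 / 2, 1 / 2), by norm_num [hU]⟩
  obtain ⟨l, hl, hexp⟩ := Complex.exists_continuousOn_eqOn_exp_comp hUsc
    (isOpen_Ioo.prod isOpen_Ioo) cΦ (by rintro ⟨x, hx, h0⟩; exact hΦ0 x hx h0)
  have hA : ∀ x ∈ {x ∈ U | hf x.1 ≤ hg x.2}, -Φ x ∈ Complex.slitPlane := by
    rintro x ⟨hx, hle⟩
    rw [Complex.mem_slitPlane_iff]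
    rcases hle.eq_or_lt with heq | hlt
    · right
      simp only [hΦ, Complex.neg_im, neg_ne_zero]
      exact sub_ne_zero.2 (hne _ hx.1 _ hx.2 heq)
    · left; simp only [hΦ, Complex.neg_re]; linarith
  have hB : ∀ x ∈ {x ∈ U | hg x.2 ≤ hf x.1}, Φ x ∈ Complex.slitPlane := by
    rintro x ⟨hx, hle⟩
    rw [Complex.mem_slitPlane_iff]
    rcases hle.eq_or_lt with heq | hlt
    · right
      exact sub_ne_zero.2 (hne _ hx.1 _ hx.2 heq.symm)
    · left; simp only [hΦ]; linarith
  -- On the region `hf ≤ hg` the number `-Φ` avoids the cut of the principal logarithm, and on `hg ≤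
  -- hf` so does `Φ`. Each region thus has a locally constant integer comparing `l` with a principal
  -- branch.
  have eA : ∀ x, ∃ n : ℤ, x ∈ U → l x = Complex.log (-Φ x) + Real.pi * Complex.I
      + n * (2 * Real.pi * Complex.I) := by
    intro x
    by_cases hx : x ∈ U
    · have h1 : Complex.exp (l x) = Complex.exp (Complex.log (-Φ x) + Real.pi * Complex.I) := by
        rw [Complex.exp_add, Complex.exp_log (neg_ne_zero.2 (hΦ0 x hx)), Complex.exp_pi_mul_I]
        have := hexp hx
        simp only [Function.comp] at this
        rw [this]; ring
      obtain ⟨n, hn⟩ := Complex.exp_eq_exp_iff_exists_int.1 h1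
      exact ⟨n, fun _ => hn⟩
    · exact ⟨0, fun h => absurd h hx⟩
  have eB : ∀ x, ∃ n : ℤ, x ∈ U → l x = Complex.log (Φ x) + n * (2 * Real.pi * Complex.I) := by
    intro x
    by_cases hx : x ∈ U
    · have h1 : Complex.exp (l x) = Complex.exp (Complex.log (Φ x)) := by
        rw [Complex.exp_log (hΦ0 x hx)]
        exact hexp hx
      obtain ⟨n, hn⟩ := Complex.exp_eq_exp_iff_exists_int.1 h1
      exact ⟨n, fun _ => hn⟩
    · exact ⟨0, fun h => absurd h hx⟩
  choose kA hkA using eA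
  choose kB hkB using eB
  have hpi : (2 * Real.pi : ℝ) ≠ 0 := by positivity
  have imA : ∀ x ∈ U, (l x).im = (Complex.log (-Φ x)).im + Real.pi + kA x * (2 * Real.pi) := by
    intro x hx
    have := congrArg Complex.im (hkA x hx)
    simpa using this
  have imB : ∀ x ∈ U, (l x).im = (Complex.log (Φ x)).im + kB x * (2 * Real.pi) := by
    intro x hx
    have := congrArg Complex.im (hkB x hx)
    simpa using this
  have cA : ContinuousOn (fun x => (kA x : ℝ)) {x ∈ U | hf x.1 ≤ hg x.2} := by
    have h1 : ContinuousOn (fun x => ((l x).im - (Complex.log (-Φ x)).im - Real.pi)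
        / (2 * Real.pi)) {x ∈ U | hf x.1 ≤ hg x.2} := by
      have hs : {x ∈ U | hf x.1 ≤ hg x.2} ⊆ U := fun x hx => hx.1
      refine ContinuousOn.div_const (ContinuousOn.sub (ContinuousOn.sub ?_ ?_) continuousOn_const) _
      · exact Complex.continuous_im.comp_continuousOn (hl.mono hs)
      · exact Complex.continuous_im.comp_continuousOn ((cΦ.mono hs).neg.clog hA)
    refine h1.congr fun x hx => ?_
    dsimp only
    rw [imA x hx.1]; field_simp; ring
  have cB : ContinuousOn (fun x => (kB x : ℝ)) {x ∈ U | hg x.2 ≤ hf x.1} := by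
    have h1 : ContinuousOn (fun x => ((l x).im - (Complex.log (Φ x)).im)
        / (2 * Real.pi)) {x ∈ U | hg x.2 ≤ hf x.1} := by
      have hs : {x ∈ U | hg x.2 ≤ hf x.1} ⊆ U := fun x hx => hx.1
      refine ContinuousOn.div_const (ContinuousOn.sub ?_ ?_) _
      · exact Complex.continuous_im.comp_continuousOn (hl.mono hs)
      · exact Complex.continuous_im.comp_continuousOn ((cΦ.mono hs).clog hB)
    refine h1.congr fun x hx => ?_
    dsimp only
    rw [imB x hx.1]; field_simp; ring
  -- Exchanging the curves turns the corner `(0, 1)` into `(1, 0)`, which is where the region `hg ≤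
  -- hf` leads.
  have cB' : ContinuousOn (fun x => (kB x.swap : ℝ))
      {x ∈ Ioo (0 : ℝ) 1 ×ˢ Ioo (0 : ℝ) 1 | hg x.1 ≤ hf x.2} :=
    cB.comp continuous_swap.continuousOn (fun x hx => ⟨⟨hx.1.2, hx.1.1⟩, hx.2⟩)
  have sameA : kA (s, t) = kA (s', t') := by
    have e1 := Hf.eventually_eq_corner Hg cA h.1 h.2.1 h.2.2.1 (h.2.2.2.imp And.left And.right)
    have e2 := Hf.eventually_eq_corner Hg cA h'.1 h'.2.1 h'.2.2.1
      (h'.2.2.2.imp And.left And.right)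
    obtain ⟨y, hy1, hy2⟩ := (e1.and e2).exists
    obtain ⟨x, hx1, hx2⟩ := (hy1.and hy2).exists
    exact hx1.trans hx2.symm
  have sameB : kB (s, t) = kB (s', t') := by
    have e1 := Hg.eventually_eq_corner Hf (k := fun x => kB x.swap) cB' h.2.1 h.1 h.2.2.1.symm
      (h.2.2.2.imp And.right And.left)
    have e2 := Hg.eventually_eq_corner Hf (k := fun x => kB x.swap) cB' h'.2.1 h'.1 h'.2.2.1.symm
      (h'.2.2.2.imp And.right And.left)
    obtain ⟨y, hy1, hy2⟩ := (e1.and e2).exists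
    obtain ⟨x, hx1, hx2⟩ := (hy1.and hy2).exists
    exact hx1.trans hx2.symm
  -- At a contact `Φ` is purely imaginary and both branches apply. The difference `kB - kA` is 1 or
  -- 0 according to the sign of the imaginary part, and it is the same at all end hits.
  have key : ∀ s t, IsEndHit hf hg s t →
      (θf s < θg t → kB (s, t) = kA (s, t) + 1) ∧ (θg t < θf s → kB (s, t) = kA (s, t)) := by
    intro s t h
    have hx : (s, t) ∈ U := ⟨h.1, h.2.1⟩
    have h1 := imA _ hx
    rw [imB _ hx, Complex.log_im, Complex.log_im] at h1
    have hre : (Φ (s, t)).re = 0 := by simp only [hΦ]; linarith [h.2.2.1]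
    constructor
    · intro hlt
      have e1 : (Φ (s, t)).arg = -(Real.pi / 2) :=
        Complex.arg_eq_neg_pi_div_two_iff.2 ⟨hre, by simp only [hΦ]; linarith⟩
      have e2 : (-Φ (s, t)).arg = Real.pi / 2 :=
        Complex.arg_eq_pi_div_two_iff.2 ⟨by simp [hre], by simp only [hΦ, Complex.neg_im]; linarith⟩
      rw [e1, e2] at h1
      have : (kB (s, t) : ℝ) = kA (s, t) + 1 := by
        apply mul_right_cancel₀ hpi; linarith
      exact_mod_cast this
    · intro hlt
      have e1 : (Φ (s, t)).arg = Real.pi / 2 :=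
        Complex.arg_eq_pi_div_two_iff.2 ⟨hre, by simp only [hΦ]; linarith⟩
      have e2 : (-Φ (s, t)).arg = -(Real.pi / 2) :=
        Complex.arg_eq_neg_pi_div_two_iff.2
          ⟨by simp [hre], by simp only [hΦ, Complex.neg_im]; linarith⟩
      rw [e1, e2] at h1
      have : (kB (s, t) : ℝ) = kA (s, t) := by
        apply mul_right_cancel₀ hpi; linarith
      exact_mod_cast this
  rcases lt_trichotomy (θf s') (θg t') with hlt' | heq | hgt
  · exact hlt'
  · exact absurd heq (hne _ h'.1 _ h'.2.1 h'.2.2.1)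
  · have h1 := (key s t h).1 hlt
    have h2 := (key s' t' h').2 hgt
    omega

/-! ### Polar coordinates with two given poles -/

open Matrix in
/-- For distinct points of the sphere there is a right-handed orthonormal frame in which they are
`(m, 0, η)` and `(m, 0, -η)`. -/
theorem S2.exists_frame {p q : S2} (hpq : p ≠ q) :
    ∃ (M : Matrix (Fin 3) (Fin 3) ℝ) (m η : ℝ), M * Mᵀ = 1 ∧ M.det = 1 ∧ 0 < η ∧
      M *ᵥ p.1.ofLp = ![m, 0, η] ∧ M *ᵥ q.1.ofLp = ![m, 0, -η] := by
  have hnorm : ∀ x : S2, x.1.ofLp ⬝ᵥ x.1.ofLp = 1 := by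
    intro x
    have h := x.2
    simp only [mem_sphere_iff_norm, sub_zero, EuclideanSpace.norm_eq, Real.sqrt_eq_one] at h
    simp only [dotProduct, ← sq]
    simpa using h
  set P : Fin 3 → ℝ := p.1.ofLp with hP
  set Q : Fin 3 → ℝ := q.1.ofLp with hQ
  have hPQ : P ≠ Q := fun h => hpq (Subtype.ext (WithLp.ofLp_injective 2 h))
  have hPP : P ⬝ᵥ P = 1 := hnorm p
  have hQQ : Q ⬝ᵥ Q = 1 := hnorm q
  -- The frame consists of the direction `n` of `P - Q`, a unit vector `u` orthogonal to both
  -- points, and `u × n`, on which `P` and `Q` have equal components.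
  obtain ⟨w, hw0, hwP, hwQ⟩ : ∃ w : Fin 3 → ℝ, w ≠ 0 ∧ w ⬝ᵥ P = 0 ∧ w ⬝ᵥ Q = 0 := by
    have hlt : Module.finrank ℝ (Fin 2 → ℝ) < Module.finrank ℝ (Fin 3 → ℝ) := by simp
    obtain ⟨w, hw, hw0⟩ := Submodule.exists_mem_ne_zero_of_ne_bot
      (LinearMap.ker_ne_bot_of_finrank_lt (f := Matrix.mulVecLin !![P 0, P 1, P 2; Q 0, Q 1, Q 2])
        hlt)
    refine ⟨w, hw0, ?_, ?_⟩
    · have := congrFun (LinearMap.mem_ker.1 hw) 0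
      simp [Matrix.mulVec, dotProduct, Fin.sum_univ_three] at this ⊢
      linarith
    · have := congrFun (LinearMap.mem_ker.1 hw) 1
      simp [Matrix.mulVec, dotProduct, Fin.sum_univ_three] at this ⊢
      linarith
  have pos : ∀ v : Fin 3 → ℝ, v ≠ 0 → 0 < v ⬝ᵥ v := fun v hv => by
    refine lt_of_le_of_ne ?_ (fun h => hv (dotProduct_self_eq_zero.1 h.symm))
    simp only [dotProduct]
    exact Finset.sum_nonneg fun i _ => mul_self_nonneg _
  have hw1 := pos w hw0
  have hd1 := pos (P - Q) (sub_ne_zero.2 hPQ)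
  set d := Real.sqrt ((P - Q) ⬝ᵥ (P - Q)) with hd
  set e := Real.sqrt (w ⬝ᵥ w) with he
  have hd0 : 0 < d := Real.sqrt_pos.2 hd1
  have he0 : 0 < e := Real.sqrt_pos.2 hw1
  have hdd : d * d = (P - Q) ⬝ᵥ (P - Q) := Real.mul_self_sqrt hd1.le
  have hee : e * e = w ⬝ᵥ w := Real.mul_self_sqrt hw1.le
  set n : Fin 3 → ℝ := d⁻¹ • (P - Q) with hn
  set u : Fin 3 → ℝ := e⁻¹ • w with hu
  have hnn : n ⬝ᵥ n = 1 := by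
    rw [hn, smul_dotProduct, dotProduct_smul, ← hdd]; simp; field_simp
  have huu : u ⬝ᵥ u = 1 := by
    rw [hu, smul_dotProduct, dotProduct_smul, ← hee]; simp; field_simp
  have huP : u ⬝ᵥ P = 0 := by rw [hu, smul_dotProduct, hwP]; simp
  have huQ : u ⬝ᵥ Q = 0 := by rw [hu, smul_dotProduct, hwQ]; simp
  have hun : u ⬝ᵥ n = 0 := by rw [hn, dotProduct_smul, dotProduct_sub, huP, huQ]; simp
  have hdd' : d * d = 2 - 2 * (P ⬝ᵥ Q) := by
    rw [hdd, sub_dotProduct, dotProduct_sub, dotProduct_sub, hPP, hQQ, dotProduct_comm Q P]; ring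
  have hnP : n ⬝ᵥ P = d / 2 := by
    rw [hn, smul_dotProduct, sub_dotProduct, hPP, dotProduct_comm Q P, smul_eq_mul]
    field_simp; linarith
  have hnQ : n ⬝ᵥ Q = -(d / 2) := by
    rw [hn, smul_dotProduct, sub_dotProduct, hQQ, smul_eq_mul]
    field_simp; linarith
  set t : Fin 3 → ℝ := crossProduct u n with ht
  have htt : t ⬝ᵥ t = 1 := by rw [ht, cross_dot_cross, huu, hnn, hun]; simp
  have htu : t ⬝ᵥ u = 0 := by rw [dotProduct_comm]; exact dot_self_cross u n
  have htn : t ⬝ᵥ n = 0 := by rw [dotProduct_comm]; exact dot_cross_self u n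
  have htPQ : t ⬝ᵥ Q = t ⬝ᵥ P := by
    have h1 : t ⬝ᵥ n = d⁻¹ * (t ⬝ᵥ P - t ⬝ᵥ Q) := by
      rw [hn, dotProduct_smul, dotProduct_sub, smul_eq_mul]
    rw [htn] at h1
    have := (mul_eq_zero.1 h1.symm).resolve_left (inv_ne_zero hd0.ne')
    linarith
  refine ⟨Matrix.of ![t, u, n], t ⬝ᵥ P, d / 2, ?_, ?_, by positivity, ?_, ?_⟩
  · ext i j
    have hij : (Matrix.of ![t, u, n] * (Matrix.of ![t, u, n])ᵀ) i j
        = ![t, u, n] i ⬝ᵥ ![t, u, n] j := rfl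
    rw [hij]
    fin_cases i <;> fin_cases j <;>
      simp [htt, htu, htn, huu, hun, hnn, dotProduct_comm u t, dotProduct_comm n t,
        dotProduct_comm n u]
  · have := triple_product_eq_det t u n
    rw [← ht, htt] at this
    exact this.symm
  · ext i
    fin_cases i
    · rfl
    · exact huP
    · exact hnP
  · ext i
    fin_cases i
    · exact htPQ
    · exact huQ
    · exact hnQ

open Matrix in
/-- Isometric right-handed coordinates in which two given points are `(m, 0, η)` and
`(m, 0, -η)`. -/
theorem S2.exists_coordinates {p q : S2} (hpq : p ≠ q) : ∃ (A : S2 → Fin 3 → ℝ) (m η : ℝ),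
    (∀ i, Continuous fun x => A x i) ∧ (∀ x y, A x = A y → x = y) ∧
    (∀ x, A x 0 ^ 2 + A x 1 ^ 2 + A x 2 ^ 2 = 1) ∧
    (∀ x y, dist x y ^ 2
      = (A x 0 - A y 0) ^ 2 + (A x 1 - A y 1) ^ 2 + (A x 2 - A y 2) ^ 2) ∧
    (∀ c x y z, IsCounterclockwise c x y z ↔ 0 < Matrix.det
      !![A c 0, A c 1, A c 2; A y 0 - A x 0, A y 1 - A x 1, A y 2 - A x 2;
        A z 0 - A x 0, A z 1 - A x 1, A z 2 - A x 2]) ∧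
    (A p 0 = m ∧ A p 1 = 0 ∧ A p 2 = η) ∧ (A q 0 = m ∧ A q 1 = 0 ∧ A q 2 = -η) ∧ 0 < η := by
  obtain ⟨M, m, η, hM, hdet, hη, hp, hq⟩ := S2.exists_frame hpq
  have hM' : Mᵀ * M = 1 := mul_eq_one_comm.1 hM
  set A : S2 → Fin 3 → ℝ := fun x => M *ᵥ x.1.ofLp with hA
  have hdot : ∀ x y : Fin 3 → ℝ, (M *ᵥ x) ⬝ᵥ (M *ᵥ y) = x ⬝ᵥ y := by
    intro x y
    rw [Matrix.dotProduct_mulVec, ← Matrix.mulVec_transpose, Matrix.mulVec_mulVec, hM',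
      Matrix.one_mulVec]
  have hsq : ∀ x, A x 0 ^ 2 + A x 1 ^ 2 + A x 2 ^ 2 = 1 := by
    intro x
    have h := x.2
    simp only [mem_sphere_iff_norm, sub_zero, EuclideanSpace.norm_eq, Real.sqrt_eq_one] at h
    have h2 := hdot x.1.ofLp x.1.ofLp
    simp only [dotProduct, Fin.sum_univ_three, Real.norm_eq_abs, sq_abs] at h2 h
    simp only [hA]; nlinarith
  have hAc : ∀ i, Continuous fun x => A x i := by
    intro i
    simp only [hA, Matrix.mulVec, dotProduct, Fin.sum_univ_three]
    fun_prop
  have hAinj : ∀ x y, A x = A y → x = y := by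
    intro x y h
    have h2 := congrArg (fun v => Mᵀ *ᵥ v) h
    simp only [hA, Matrix.mulVec_mulVec, hM', Matrix.one_mulVec] at h2
    exact Subtype.ext (WithLp.ofLp_injective 2 h2)
  have hAp : A p 0 = m ∧ A p 1 = 0 ∧ A p 2 = η := by simp only [hA, hp]; simp
  have hAq : A q 0 = m ∧ A q 1 = 0 ∧ A q 2 = -η := by simp only [hA, hq]; simp
  have hdist : ∀ x y, dist x y ^ 2
      = (A x 0 - A y 0) ^ 2 + (A x 1 - A y 1) ^ 2 + (A x 2 - A y 2) ^ 2 := by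
    intro x y
    rw [Subtype.dist_eq, EuclideanSpace.dist_eq, Real.sq_sqrt (by positivity)]
    have h := hdot (x.1.ofLp - y.1.ofLp) (x.1.ofLp - y.1.ofLp)
    simp only [Matrix.mulVec_sub, dotProduct, Fin.sum_univ_three, Pi.sub_apply] at h
    simp only [hA, Fin.sum_univ_three, Real.dist_eq, sq_abs]
    nlinarith
  have hccw : ∀ c x y z, IsCounterclockwise c x y z ↔ 0 < Matrix.det
      !![A c 0, A c 1, A c 2; A y 0 - A x 0, A y 1 - A x 1, A y 2 - A x 2;
        A z 0 - A x 0, A z 1 - A x 1, A z 2 - A x 2] := by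
    intro c x y z
    have h : !![A c 0, A c 1, A c 2; A y 0 - A x 0, A y 1 - A x 1, A y 2 - A x 2;
        A z 0 - A x 0, A z 1 - A x 1, A z 2 - A x 2] = !![c.1 0, c.1 1, c.1 2;
        y.1 0 - x.1 0, y.1 1 - x.1 1, y.1 2 - x.1 2;
        z.1 0 - x.1 0, z.1 1 - x.1 1, z.1 2 - x.1 2] * Mᵀ := by
      ext i j
      fin_cases i <;> fin_cases j <;>
        simp [hA, Matrix.mul_apply, Matrix.mulVec, dotProduct, Fin.sum_univ_three] <;> ring
    rw [h, Matrix.det_mul, Matrix.det_transpose, hdet, mul_one]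
    rfl
  exact ⟨A, m, η, hAc, hAinj, hsq, hdist, hccw, hAp, hAq, hη⟩

/-- A chart of the sphere with poles `p` and `q`: a height running from `-1` at `p` to `1` at `q`
and a complex coordinate vanishing at the poles. Near each of the poles the height is a function of
the distance and the complex coordinate is isometric, counterclockwise around `p` and clockwise
around `q`. -/
structure PolarChart (p q : S2) where
  Z : S2 → ℂ
  H : S2 → ℝ
  radius : ℝ
  continuous_Z : Continuous Z
  continuous_H : Continuous H
  normSq_add_sq : ∀ x, Complex.normSq (Z x) + H x ^ 2 = 1
  injective : ∀ x y, Z x = Z y → H x = H y → x = y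
  H_source : H p = -1
  H_target : H q = 1
  radius_pos : 0 < radius
  H_near_source : ∀ x, dist x p ≤ radius → H x = dist x p ^ 2 / 2 - 1
  H_near_target : ∀ x, dist x q ≤ radius → H x = 1 - dist x q ^ 2 / 2
  ccw_source : ∀ x y z, dist x p ≤ radius → dist y p ≤ radius → dist z p ≤ radius →
    (IsCounterclockwise p x y z ↔ 0 < (starRingEnd ℂ (Z y - Z x) * (Z z - Z x)).im)
  ccw_target : ∀ x y z, dist x q ≤ radius → dist y q ≤ radius → dist z q ≤ radius →
    (IsCounterclockwise q x y z ↔ (starRingEnd ℂ (Z y - Z x) * (Z z - Z x)).im < 0)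

/-- The poles need not be antipodal. A rotation about the third axis, by an angle depending on the
third coordinate, fixes a neighbourhood of `p` and is a half-turn near `q`, so it carries `q` to
`-p`. Being locally a rigid rotation at both poles, it preserves distances and orientation there. -/
theorem nonempty_polarChart {p q : S2} (hpq : p ≠ q) : Nonempty (PolarChart p q) := by
  obtain ⟨A, m, η, hAc, hAinj, hsq, hdist, hccw, hAp, hAq, hη⟩ := S2.exists_coordinates hpq
  have hmη : m ^ 2 + η ^ 2 = 1 := by
    have := hsq p; rw [hAp.1, hAp.2.1, hAp.2.2] at this; linarith
  -- The angle is 0 where the third coordinate is at least `η / 2` and `π` where it is at most `-(η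
  -- / 2)`. These regions contain the balls of radius `η / 2` about the poles.
  set φ : S2 → ℝ := fun x => Real.pi * max 0 (min 1 ((η / 2 - A x 2) / η)) with hφ
  have hφc : Continuous φ := by
    have := hAc 2
    simp only [hφ]; fun_prop
  have hφp : ∀ x, η / 2 ≤ A x 2 → φ x = 0 := by
    intro x hx
    have : (η / 2 - A x 2) / η ≤ 0 := div_nonpos_of_nonpos_of_nonneg (by linarith) hη.le
    simp only [hφ]
    rw [max_eq_left ((min_le_right _ _).trans this), mul_zero]
  have hφq : ∀ x, A x 2 ≤ -(η / 2) → φ x = Real.pi := by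
    intro x hx
    have : 1 ≤ (η / 2 - A x 2) / η := by rw [le_div_iff₀ hη]; linarith
    simp only [hφ]
    rw [min_eq_left this, max_eq_right zero_le_one, mul_one]
  have nearp : ∀ x, dist x p ≤ η / 2 → φ x = 0 := by
    intro x hx
    apply hφp
    have h1 := hdist x p
    have h2 : dist x p ^ 2 ≤ (η / 2) ^ 2 := pow_le_pow_left₀ dist_nonneg hx 2
    rw [hAp.2.2] at h1
    have h3 : (A x 2 - η) ^ 2 ≤ (η / 2) ^ 2 := by nlinarith
    linarith [(abs_le.1 (abs_le_of_sq_le_sq h3 (by linarith))).1]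
  have nearq : ∀ x, dist x q ≤ η / 2 → φ x = Real.pi := by
    intro x hx
    apply hφq
    have h1 := hdist x q
    have h2 : dist x q ^ 2 ≤ (η / 2) ^ 2 := pow_le_pow_left₀ dist_nonneg hx 2
    rw [hAq.2.2] at h1
    have h3 : (A x 2 - -η) ^ 2 ≤ (η / 2) ^ 2 := by nlinarith
    linarith [(abs_le.1 (abs_le_of_sq_le_sq h3 (by linarith))).2]
  set B0 : S2 → ℝ := fun x => A x 0 * Real.cos (φ x) - A x 1 * Real.sin (φ x) with hB0
  set B1 : S2 → ℝ := fun x => A x 0 * Real.sin (φ x) + A x 1 * Real.cos (φ x) with hB1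
  have hBsq : ∀ x, B0 x ^ 2 + B1 x ^ 2 = A x 0 ^ 2 + A x 1 ^ 2 := by
    intro x
    simp only [hB0, hB1]
    linear_combination (A x 0 ^ 2 + A x 1 ^ 2) * Real.sin_sq_add_cos_sq (φ x)
  have hφ' : ∀ x y, A x 2 = A y 2 → φ x = φ y := fun x y h => by simp only [hφ, h]
  clear_value φ
  have hc0 := hAc 0
  have hc1 := hAc 1
  have hc2 := hAc 2
  -- Coordinates of the twisted point in the right-handed orthonormal frame `(η, 0, -m)`, `(0, 1,
  -- 0)`, `(m, 0, η)`, whose last vector is `p`; the height is minus the last coordinate.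
  refine ⟨⟨fun x => ⟨η * B0 x - m * A x 2, B1 x⟩, fun x => -(m * B0 x + η * A x 2), η / 2,
    ?_, ?_, ?_, ?_, ?_, ?_, by positivity, ?_, ?_, ?_, ?_⟩⟩
  · refine Complex.equivRealProdCLM.symm.continuous.comp (Continuous.prodMk ?_ ?_)
    · simp only [hB0]; fun_prop
    · show Continuous fun x => A x 0 * Real.sin (φ x) + A x 1 * Real.cos (φ x)
      fun_prop
  · simp only [hB0]; fun_prop
  · intro x
    rw [Complex.normSq_mk]
    linear_combination hsq x + hBsq x + (B0 x ^ 2 + A x 2 ^ 2) * hmη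
  · intro x y hZ hH
    have h1 := congrArg Complex.re hZ
    have h2 := congrArg Complex.im hZ
    dsimp only at h1 h2 hH
    have e0 : B0 x = B0 y := by
      linear_combination η * h1 - m * hH - (B0 x - B0 y) * hmη
    have e2 : A x 2 = A y 2 := by
      linear_combination -m * h1 - η * hH - (A x 2 - A y 2) * hmη
    have eφ : φ x = φ y := hφ' x y e2
    simp only [hB0, hB1, eφ] at e0 h2
    have hcs := Real.sin_sq_add_cos_sq (φ y)
    apply hAinj
    ext i
    fin_cases i
    · show A x 0 = A y 0
      linear_combination Real.cos (φ y) * e0 + Real.sin (φ y) * h2 - (A x 0 - A y 0) * hcs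
    · show A x 1 = A y 1
      linear_combination -Real.sin (φ y) * e0 + Real.cos (φ y) * h2 - (A x 1 - A y 1) * hcs
    · exact e2
  · have h := nearp p (by simp; linarith)
    simp only [hB0, h, hAp.1, hAp.2.1, hAp.2.2, Real.cos_zero, Real.sin_zero]
    linear_combination -hmη
  · have h := nearq q (by simp; linarith)
    simp only [hB0, h, hAq.1, hAq.2.1, hAq.2.2, Real.cos_pi, Real.sin_pi]
    linear_combination hmη
  · intro x hx
    simp only [hB0, nearp x hx, Real.cos_zero, Real.sin_zero]
    have h := hdist x p
    rw [hAp.1, hAp.2.1, hAp.2.2] at h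
    rw [h]
    linear_combination -hsq x / 2 - hmη / 2
  · intro x hx
    simp only [hB0, nearq x hx, Real.cos_pi, Real.sin_pi]
    have h := hdist x q
    rw [hAq.1, hAq.2.1, hAq.2.2] at h
    rw [h]
    linear_combination hsq x / 2 + hmη / 2
  · intro x y z hx hy hz
    rw [hccw, Matrix.det_fin_three, hAp.1, hAp.2.1, hAp.2.2]
    simp only [hB0, hB1, nearp _ hx, nearp _ hy, nearp _ hz, Real.cos_zero, Real.sin_zero,
      Complex.mul_im, Complex.conj_re, Complex.conj_im, Complex.sub_re, Complex.sub_im]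
    simp only [Matrix.of_apply, Matrix.cons_val]
    constructor <;> intro h <;> linarith
  · intro x y z hx hy hz
    rw [hccw, Matrix.det_fin_three, hAq.1, hAq.2.1, hAq.2.2]
    simp only [hB0, hB1, nearq _ hx, nearq _ hy, nearq _ hz, Real.cos_pi, Real.sin_pi,
      Complex.mul_im, Complex.conj_re, Complex.conj_im, Complex.sub_re, Complex.sub_im]
    simp only [Matrix.of_apply, Matrix.cons_val]
    constructor <;> intro h <;> linarith

/-! ### Lifted arcs and theta curves -/

theorem IsFirstHit.unique {a b : S2} {γ : Path a b} {ρ : ℝ} {x y : S2} (hx : IsFirstHit γ ρ x)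
    (hy : IsFirstHit γ ρ y) : x = y := by
  obtain ⟨s, rfl, hs, hs'⟩ := hx
  obtain ⟨t, rfl, ht, ht'⟩ := hy
  rcases lt_trichotomy s t with h | h | h
  · exact absurd hs (ht' s h).ne
  · rw [h]
  · exact absurd ht (hs' t h).ne

theorem exists_isFirstHit {a b : S2} (γ : Path a b) {ρ : ℝ} (hρ : 0 ≤ ρ) (hab : ρ ≤ dist b a) :
    ∃ x, IsFirstHit γ ρ x := by
  have hc : Continuous fun t => dist (γ t) a := by fun_prop
  have hcl : IsClosed {t : unitInterval | ρ ≤ dist (γ t) a} := isClosed_le continuous_const hc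
  obtain ⟨t, ht, hmin⟩ := hcl.isCompact.exists_isLeast ⟨1, by simpa using hab⟩
  refine ⟨γ t, t, rfl, le_antisymm ?_ ht, fun s hs => ?_⟩
  · obtain ⟨s, hs, hs'⟩ := intermediate_value_Icc (show (0 : unitInterval) ≤ t from t.2.1)
      hc.continuousOn (show ρ ∈ Icc _ _ from ⟨by simpa using hρ, ht⟩)
    have : t ≤ s := hmin (show ρ ≤ dist (γ s) a from hs'.ge)
    rw [le_antisymm this hs.2]
    exact hs'.le
  · by_contra h
    exact absurd (hmin (not_lt.1 h)) (not_le.2 hs)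

/-- Paths from a common point leave it in counterclockwise order. -/
def LeaveCounterclockwise {p a b c : S2} (α : Path p a) (β : Path p b) (δ : Path p c) : Prop :=
  ∀ᶠ ρ : ℝ in 𝓝[>] 0, ∃ x y z : S2, IsFirstHit α ρ x ∧ IsFirstHit β ρ y ∧ IsFirstHit δ ρ z ∧
    IsCounterclockwise p x y z

/-- The expression is twice the signed area of a triangle inscribed in a circle of radius `|κ|`,
which is `4 κ²` times the sines of the half-differences of the angles. Those half-differences lie in
`(0, π)`. -/
theorem Complex.im_conj_sub_mul_sub_pos {κ a b c : ℝ} (hκ : κ ≠ 0) (hab : a < b) (hbc : b < c)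
    (hca : c < a + 2 * Real.pi) :
    0 < (starRingEnd ℂ (κ * Complex.exp (b * Complex.I) - κ * Complex.exp (a * Complex.I)) *
      (κ * Complex.exp (c * Complex.I) - κ * Complex.exp (a * Complex.I))).im := by
  have h : (starRingEnd ℂ (κ * Complex.exp (b * Complex.I) - κ * Complex.exp (a * Complex.I)) *
      (κ * Complex.exp (c * Complex.I) - κ * Complex.exp (a * Complex.I))).im
      = 4 * κ ^ 2 * (Real.sin ((b - a) / 2) * Real.sin ((c - b) / 2)
        * Real.sin ((c - a) / 2)) := by
    obtain ⟨u, rfl⟩ : ∃ u, b = a + 2 * u := ⟨(b - a) / 2, by ring⟩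
    obtain ⟨v, rfl⟩ : ∃ v, c = a + 2 * u + 2 * v := ⟨(c - (a + 2 * u)) / 2, by ring⟩
    have e1 : (a + 2 * u - a) / 2 = u := by ring
    have e2 : (a + 2 * u + 2 * v - (a + 2 * u)) / 2 = v := by ring
    have e3 : (a + 2 * u + 2 * v - a) / 2 = u + v := by ring
    have e4 : Real.sin (a + 2 * u + 2 * v - (a + 2 * u)) + Real.sin (a + 2 * u - a)
        - Real.sin (a + 2 * u + 2 * v - a)
        = 4 * (Real.sin u * Real.sin v * Real.sin (u + v)) := by
      rw [show a + 2 * u + 2 * v - (a + 2 * u) = 2 * v by ring, show a + 2 * u - a = 2 * u by ring,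
        show a + 2 * u + 2 * v - a = 2 * u + 2 * v by ring, Real.sin_add, Real.sin_add,
        Real.sin_two_mul, Real.sin_two_mul, Real.cos_two_mul, Real.cos_two_mul]
      linear_combination -4 * Real.sin u * Real.cos u * Real.sin_sq_add_cos_sq v
        - 4 * Real.sin v * Real.cos v * Real.sin_sq_add_cos_sq u
    rw [e1, e2, e3, mul_right_comm, ← e4]
    generalize a + 2 * u + 2 * v = c
    generalize a + 2 * u = b
    simp only [Complex.exp_mul_I, ← Complex.ofReal_cos, ← Complex.ofReal_sin, Complex.mul_im,
      Complex.conj_re, Complex.conj_im, Complex.sub_re, Complex.sub_im, Complex.mul_re,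
      Complex.add_re, Complex.add_im, Complex.ofReal_re, Complex.ofReal_im, Complex.I_re,
      Complex.I_im, Real.sin_sub]
    ring
  rw [h]
  have h1 : 0 < Real.sin ((b - a) / 2) := Real.sin_pos_of_pos_of_lt_pi (by linarith) (by linarith)
  have h2 : 0 < Real.sin ((c - b) / 2) := Real.sin_pos_of_pos_of_lt_pi (by linarith) (by linarith)
  have h3 : 0 < Real.sin ((c - a) / 2) := Real.sin_pos_of_pos_of_lt_pi (by linarith) (by linarith)
  positivity

/-- A lift of a path between the poles to the universal cover of the doubly punctured sphere. -/
structure PolarChart.Strand {p q : S2} (C : PolarChart p q) (γ : Path p q) where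
  angle : ℝ → ℝ
  continuousOn_angle : ContinuousOn angle (Ioo 0 1)
  profile : IsHeightProfile fun t => C.H (γ.extend t)
  Z_eq : ∀ t ∈ Ioo (0 : ℝ) 1, C.Z (γ.extend t)
    = (Real.sqrt (1 - C.H (γ.extend t) ^ 2) : ℝ) * Complex.exp (angle t * Complex.I)

namespace PolarChart

variable {p q : S2} (C : PolarChart p q)

theorem sqrt_eq_norm (x : S2) : Real.sqrt (1 - C.H x ^ 2) = ‖C.Z x‖ := by
  rw [← C.normSq_add_sq x, add_sub_cancel_right, Complex.normSq_eq_norm_sq,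
    Real.sqrt_sq (norm_nonneg _)]

theorem Z_eq_zero_iff (x : S2) : C.Z x = 0 ↔ x = p ∨ x = q := by
  have hZ : ∀ y, C.H y ^ 2 = 1 → C.Z y = 0 := fun y hy => by
    have := C.normSq_add_sq y
    rw [hy] at this
    exact Complex.normSq_eq_zero.1 (by linarith)
  have hp : C.Z p = 0 := hZ p (by rw [C.H_source]; norm_num)
  have hq : C.Z q = 0 := hZ q (by rw [C.H_target]; norm_num)
  refine ⟨fun h => ?_, by rintro (rfl | rfl) <;> assumption⟩
  have h1 := C.normSq_add_sq x
  rw [h, map_zero, zero_add, sq_eq_one_iff] at h1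
  rcases h1 with h1 | h1
  · exact Or.inr (C.injective _ _ (h.trans hq.symm) (h1.trans C.H_target.symm))
  · exact Or.inl (C.injective _ _ (h.trans hp.symm) (h1.trans C.H_source.symm))

/-- The angle is the imaginary part of a continuous logarithm of `C.Z` along the open arc, where
`C.Z` vanishes nowhere. Nothing is claimed about its limits at the ends. -/
theorem nonempty_strand (γ : Path p q)
    (hγ : ∀ t, t ≠ 0 → t ≠ 1 → γ t ≠ p ∧ γ t ≠ q) : Nonempty (C.Strand γ) := by
  have hγ' : ∀ t ∈ Ioo (0 : ℝ) 1, C.Z (γ.extend t) ≠ 0 := by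
    intro t ht h0
    rw [γ.extend_apply ⟨ht.1.le, ht.2.le⟩, C.Z_eq_zero_iff] at h0
    have := hγ ⟨t, ht.1.le, ht.2.le⟩ (fun h => ht.1.ne' (congrArg Subtype.val h))
      (fun h => ht.2.ne (congrArg Subtype.val h))
    exact h0.elim this.1 this.2
  have hc : Continuous fun t => C.Z (γ.extend t) := C.continuous_Z.comp γ.continuous_extend
  obtain ⟨l, hl, hexp⟩ := Complex.exists_continuousOn_eqOn_exp_comp
    ((convex_Ioo (0 : ℝ) 1).isSimplyConnected ⟨1 / 2, by norm_num⟩) isOpen_Ioo hc.continuousOn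
    (by rintro ⟨t, ht, h0⟩; exact hγ' t ht h0)
  have hH : ∀ t ∈ Ioo (0 : ℝ) 1, C.H (γ.extend t) ^ 2 < 1 := by
    intro t ht
    have := Complex.normSq_pos.2 (hγ' t ht)
    linarith [C.normSq_add_sq (γ.extend t)]
  refine ⟨⟨fun t => (l t).im, Complex.continuous_im.comp_continuousOn hl,
    ⟨(C.continuous_H.comp γ.continuous_extend).continuousOn, by simp [C.H_source],
      by simp [C.H_target], fun t ht => ?_, fun t ht => ?_⟩, fun t ht => ?_⟩⟩
  · exact (abs_lt_of_sq_lt_sq' (by simpa using hH t ht) zero_le_one).1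
  · exact (abs_lt_of_sq_lt_sq' (by simpa using hH t ht) zero_le_one).2
  · have h1 : Complex.exp (l t) = C.Z (γ.extend t) := hexp ht
    rw [C.sqrt_eq_norm, ← h1, Complex.norm_exp, Complex.ofReal_exp, ← Complex.exp_add,
      Complex.re_add_im]

namespace Strand

variable {C}

/-- The strand with the angle changed by a multiple of `2π`. -/
noncomputable def shift {γ : Path p q} (S : C.Strand γ) (n : ℤ) : C.Strand γ where
  angle t := S.angle t + n * (2 * Real.pi)
  continuousOn_angle := S.continuousOn_angle.add continuousOn_const
  profile := S.profile
  Z_eq t ht := by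
    rw [S.Z_eq t ht]
    congr 1
    rw [Complex.exp_eq_exp_iff_exists_int]
    exact ⟨-n, by push_cast; ring⟩

theorem angle_ne {γ γ' : Path p q} (S : C.Strand γ) (S' : C.Strand γ')
    (hd : ∀ s t, s ≠ 0 → s ≠ 1 → γ s ≠ γ' t) :
    ∀ s ∈ Ioo (0 : ℝ) 1, ∀ t ∈ Ioo (0 : ℝ) 1,
      C.H (γ.extend s) = C.H (γ'.extend t) → S.angle s ≠ S'.angle t := by
  intro s hs t ht hH ha
  have h1 : γ.extend s = γ'.extend t := by
    refine C.injective _ _ ?_ hH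
    rw [S.Z_eq s hs, S'.Z_eq t ht, hH, ha]
  rw [γ.extend_apply ⟨hs.1.le, hs.2.le⟩, γ'.extend_apply ⟨ht.1.le, ht.2.le⟩] at h1
  exact hd _ _ (fun h => hs.1.ne' (congrArg Subtype.val h))
    (fun h => hs.2.ne (congrArg Subtype.val h)) h1

/-- The parameter of a first hit on a small circle around the source. -/
theorem exists_of_firstHit {γ : Path p q} {ρ : ℝ} {x : S2} (hρ : 0 < ρ)
    (hr : ρ ≤ C.radius) (hpq : ρ < dist p q) (hx : IsFirstHit γ ρ x) :
    ∃ t ∈ Ioo (0 : ℝ) 1, γ.extend t = x ∧ C.H x = ρ ^ 2 / 2 - 1 ∧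
      ∀ r ∈ Ioo 0 t, C.H (γ.extend r) < C.H (γ.extend t) := by
  obtain ⟨t, rfl, hd, hlt⟩ := hx
  have h0 : t ≠ 0 := by rintro rfl; simp at hd; exact hρ.ne hd
  have h1 : t ≠ 1 := by
    rintro rfl; rw [γ.target, dist_comm] at hd; exact hpq.ne' hd
  have e : γ.extend t = γ t := by simp
  have hH : C.H (γ t) = ρ ^ 2 / 2 - 1 := by rw [C.H_near_source _ (hd.trans_le hr), hd]
  refine ⟨t, ⟨unitInterval.pos_iff_ne_zero.2 h0, unitInterval.lt_one_iff_ne_one.2 h1⟩, e, hH,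
    fun r hr' => ?_⟩
  have hr1 : r ∈ unitInterval := ⟨hr'.1.le, hr'.2.le.trans t.2.2⟩
  rw [e, γ.extend_apply hr1, hH]
  have h2 := hlt ⟨r, hr1⟩ hr'.2
  rw [C.H_near_source _ (h2.le.trans hr)]
  nlinarith [dist_nonneg (x := γ ⟨r, hr1⟩) (y := p)]

/-- The parameter of a last exit through a small circle around the target. -/
theorem exists_of_firstHit_symm {γ : Path p q} {ρ : ℝ} {x : S2} (hρ : 0 < ρ)
    (hr : ρ ≤ C.radius) (hpq : ρ < dist p q) (hx : IsFirstHit γ.symm ρ x) :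
    ∃ t ∈ Ioo (0 : ℝ) 1, γ.extend t = x ∧ C.H x = 1 - ρ ^ 2 / 2 ∧
      ∀ r ∈ Ioo t 1, C.H (γ.extend t) < C.H (γ.extend r) := by
  obtain ⟨t, rfl, hd, hlt⟩ := hx
  have h0 : t ≠ 0 := by rintro rfl; simp at hd; exact hρ.ne hd
  have h1 : t ≠ 1 := by
    rintro rfl; rw [γ.symm.target] at hd; exact hpq.ne' hd
  have e : γ.extend (1 - t) = γ.symm t := by
    rw [γ.extend_apply ⟨sub_nonneg.2 t.2.2, sub_le_self _ t.2.1⟩]; rfl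
  have hH : C.H (γ.symm t) = 1 - ρ ^ 2 / 2 := by rw [C.H_near_target _ (hd.trans_le hr), hd]
  have h0' : (0 : ℝ) < t := unitInterval.pos_iff_ne_zero.2 h0
  have h1' : (t : ℝ) < 1 := unitInterval.lt_one_iff_ne_one.2 h1
  refine ⟨1 - t, ⟨by linarith, by linarith⟩, e, hH, fun r hr' => ?_⟩
  have hr1 : 1 - r ∈ unitInterval := ⟨by linarith [hr'.2], by linarith [hr'.1]⟩
  have hr2 : r ∈ unitInterval := ⟨by linarith [hr'.1], hr'.2.le⟩
  have e2 : γ.extend r = γ.symm ⟨1 - r, hr1⟩ := by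
    rw [γ.extend_apply hr2, Path.symm_apply]
    congr 1
    ext
    simp
  rw [e, e2, hH]
  have h2 := hlt ⟨1 - r, hr1⟩ (show 1 - r < (t : ℝ) by linarith [hr'.1])
  rw [C.H_near_target _ (h2.le.trans hr)]
  nlinarith [dist_nonneg (x := γ.symm ⟨1 - r, hr1⟩) (y := q)]

/-- The order of three strands at one end hit determines the order at all the end hits, and so
the orders in which the paths leave both poles. -/
theorem leave_of_lt {γ₁ γ₂ γ₃ : Path p q} (hpq : p ≠ q) (S₁ : C.Strand γ₁) (S₂ : C.Strand γ₂)
    (S₃ : C.Strand γ₃) (d₁₂ : ∀ s t, s ≠ 0 → s ≠ 1 → γ₁ s ≠ γ₂ t)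
    (d₂₃ : ∀ s t, s ≠ 0 → s ≠ 1 → γ₂ s ≠ γ₃ t) (d₃₁ : ∀ s t, s ≠ 0 → s ≠ 1 → γ₃ s ≠ γ₁ t)
    {t₁ t₂ t₃ : ℝ}
    (h₁₂ : IsEndHit (fun t => C.H (γ₁.extend t)) (fun t => C.H (γ₂.extend t)) t₁ t₂)
    (h₂₃ : IsEndHit (fun t => C.H (γ₂.extend t)) (fun t => C.H (γ₃.extend t)) t₂ t₃)
    (h₃₁ : IsEndHit (fun t => C.H (γ₃.extend t)) (fun t => C.H (γ₁.extend t)) t₃ t₁)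
    (l₁₂ : S₁.angle t₁ < S₂.angle t₂) (l₂₃ : S₂.angle t₂ < S₃.angle t₃)
    (l₃₁ : S₃.angle t₃ < (S₁.shift 1).angle t₁) :
    LeaveCounterclockwise γ₁ γ₂ γ₃ ∧ LeaveCounterclockwise γ₁.symm γ₃.symm γ₂.symm := by
  have key : ∀ {s₁ s₂ s₃ : ℝ},
      IsEndHit (fun t => C.H (γ₁.extend t)) (fun t => C.H (γ₂.extend t)) s₁ s₂ →
      IsEndHit (fun t => C.H (γ₂.extend t)) (fun t => C.H (γ₃.extend t)) s₂ s₃ →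
      IsEndHit (fun t => C.H (γ₃.extend t)) (fun t => C.H (γ₁.extend t)) s₃ s₁ →
      0 < (starRingEnd ℂ (C.Z (γ₂.extend s₂) - C.Z (γ₁.extend s₁)) *
        (C.Z (γ₃.extend s₃) - C.Z (γ₁.extend s₁))).im := by
    intro s₁ s₂ s₃ k₁₂ k₂₃ k₃₁
    have m₁₂ := S₁.profile.endHit_order S₂.profile S₁.continuousOn_angle S₂.continuousOn_angle
      (S₁.angle_ne S₂ d₁₂) h₁₂ k₁₂ l₁₂
    have m₂₃ := S₂.profile.endHit_order S₃.profile S₂.continuousOn_angle S₃.continuousOn_angle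
      (S₂.angle_ne S₃ d₂₃) h₂₃ k₂₃ l₂₃
    -- The cyclic order is three linear ones: the last compares the third strand with the first one
    -- moved up by a full turn.
    have m₃₁ := S₃.profile.endHit_order S₁.profile S₃.continuousOn_angle
      (S₁.shift 1).continuousOn_angle (S₃.angle_ne (S₁.shift 1) d₃₁) h₃₁ k₃₁ l₃₁
    have m : S₃.angle s₃ < S₁.angle s₁ + 2 * Real.pi := by simpa [shift] using m₃₁
    have e₁₂ : C.H (γ₁.extend s₁) = C.H (γ₂.extend s₂) := k₁₂.2.2.1
    have e₂₃ : C.H (γ₂.extend s₂) = C.H (γ₃.extend s₃) := k₂₃.2.2.1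
    have z₁ := S₁.Z_eq s₁ k₁₂.1
    have z₂ := S₂.Z_eq s₂ k₂₃.1
    have z₃ := S₃.Z_eq s₃ k₃₁.1
    rw [← e₁₂] at z₂
    rw [← e₂₃, ← e₁₂] at z₃
    rw [z₁, z₂, z₃]
    refine Complex.im_conj_sub_mul_sub_pos ?_ m₁₂ m₂₃ m
    have h1 := S₁.profile.lower s₁ k₁₂.1
    have h2 := S₁.profile.upper s₁ k₁₂.1
    exact (Real.sqrt_pos.2 (by nlinarith)).ne'
  have hd : 0 < min C.radius (dist p q) := lt_min C.radius_pos (dist_pos.2 hpq)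
  constructor
  · filter_upwards [Ioo_mem_nhdsGT hd] with ρ hρ
    have hr : ρ ≤ C.radius := hρ.2.le.trans (min_le_left _ _)
    have hr' : ρ < dist p q := hρ.2.trans_le (min_le_right _ _)
    have ex : ∀ γ : Path p q, ∃ x, IsFirstHit γ ρ x := fun γ =>
      exists_isFirstHit γ hρ.1.le (by rw [dist_comm]; exact hr'.le)
    obtain ⟨x₁, hx₁⟩ := ex γ₁
    obtain ⟨x₂, hx₂⟩ := ex γ₂
    obtain ⟨x₃, hx₃⟩ := ex γ₃
    refine ⟨x₁, x₂, x₃, hx₁, hx₂, hx₃, ?_⟩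
    have near : ∀ {γ : Path p q} {x : S2}, IsFirstHit γ ρ x → dist x p ≤ C.radius := by
      rintro γ x ⟨_, -, h, -⟩; exact h.trans_le hr
    rw [C.ccw_source _ _ _ (near hx₁) (near hx₂) (near hx₃)]
    obtain ⟨s₁, i₁, rfl, e₁, f₁⟩ := exists_of_firstHit hρ.1 hr hr' hx₁
    obtain ⟨s₂, i₂, rfl, e₂, f₂⟩ := exists_of_firstHit hρ.1 hr hr' hx₂
    obtain ⟨s₃, i₃, rfl, e₃, f₃⟩ := exists_of_firstHit hρ.1 hr hr' hx₃
    exact key ⟨i₁, i₂, e₁.trans e₂.symm, Or.inl ⟨f₁, f₂⟩⟩ ⟨i₂, i₃, e₂.trans e₃.symm,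
      Or.inl ⟨f₂, f₃⟩⟩ ⟨i₃, i₁, e₃.trans e₁.symm, Or.inl ⟨f₃, f₁⟩⟩
  · filter_upwards [Ioo_mem_nhdsGT hd] with ρ hρ
    have hr : ρ ≤ C.radius := hρ.2.le.trans (min_le_left _ _)
    have hr' : ρ < dist p q := hρ.2.trans_le (min_le_right _ _)
    have ex : ∀ γ : Path p q, ∃ x, IsFirstHit γ.symm ρ x := fun γ =>
      exists_isFirstHit γ.symm hρ.1.le hr'.le
    obtain ⟨x₁, hx₁⟩ := ex γ₁
    obtain ⟨x₂, hx₂⟩ := ex γ₂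
    obtain ⟨x₃, hx₃⟩ := ex γ₃
    refine ⟨x₁, x₃, x₂, hx₁, hx₃, hx₂, ?_⟩
    have near : ∀ {γ : Path p q} {x : S2}, IsFirstHit γ.symm ρ x → dist x q ≤ C.radius := by
      rintro γ x ⟨_, -, h, -⟩; exact h.trans_le hr
    -- The complex coordinate is clockwise around the target, which is what reverses the order
    -- there.
    rw [C.ccw_target _ _ _ (near hx₁) (near hx₃) (near hx₂)]
    obtain ⟨s₁, i₁, rfl, e₁, f₁⟩ := exists_of_firstHit_symm hρ.1 hr hr' hx₁
    obtain ⟨s₂, i₂, rfl, e₂, f₂⟩ := exists_of_firstHit_symm hρ.1 hr hr' hx₂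
    obtain ⟨s₃, i₃, rfl, e₃, f₃⟩ := exists_of_firstHit_symm hρ.1 hr hr' hx₃
    have := key ⟨i₁, i₂, e₁.trans e₂.symm, Or.inr ⟨f₁, f₂⟩⟩ ⟨i₂, i₃, e₂.trans e₃.symm,
      Or.inr ⟨f₂, f₃⟩⟩ ⟨i₃, i₁, e₃.trans e₁.symm, Or.inr ⟨f₃, f₁⟩⟩
    simp only [Complex.mul_im, Complex.conj_re, Complex.conj_im] at this ⊢
    linarith

/-- A strand can be shifted so that a given angle lies within one turn above a given one. -/
theorem exists_shift {γ γ' : Path p q} (S : C.Strand γ) (S' : C.Strand γ')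
    (hd : ∀ s t, s ≠ 0 → s ≠ 1 → γ s ≠ γ' t) {s t : ℝ} (hs : s ∈ Ioo (0 : ℝ) 1)
    (ht : t ∈ Ioo (0 : ℝ) 1) (hH : C.H (γ.extend s) = C.H (γ'.extend t)) :
    ∃ n : ℤ, S.angle s < (S'.shift n).angle t ∧ (S'.shift n).angle t < (S.shift 1).angle s := by
  obtain ⟨n, hn, -⟩ := existsUnique_add_zsmul_mem_Ioc Real.two_pi_pos (S'.angle t) (S.angle s)
  refine ⟨n, by simpa [shift] using hn.1, lt_of_le_of_ne (by simpa [shift] using hn.2) ?_⟩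
  -- The upper end of the half-open interval is excluded: equal angles at equal height would be a
  -- common point of the arcs.
  exact ((S.shift 1).angle_ne (S'.shift n) hd s hs t ht hH).symm

end Strand

end PolarChart

/-- In a theta curve the three arcs leave one branch point in the order opposite to the one in
which they leave the other. -/
theorem leaveCounterclockwise_theta {p q : S2} (hpq : p ≠ q) (γ₁ γ₂ γ₃ : Path p q)
    (i₁ : ∀ t, t ≠ 0 → t ≠ 1 → γ₁ t ≠ p ∧ γ₁ t ≠ q)
    (i₂ : ∀ t, t ≠ 0 → t ≠ 1 → γ₂ t ≠ p ∧ γ₂ t ≠ q)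
    (i₃ : ∀ t, t ≠ 0 → t ≠ 1 → γ₃ t ≠ p ∧ γ₃ t ≠ q)
    (d₁₂ : ∀ s t, s ≠ 0 → s ≠ 1 → γ₁ s ≠ γ₂ t) (d₁₃ : ∀ s t, s ≠ 0 → s ≠ 1 → γ₁ s ≠ γ₃ t)
    (d₂₃ : ∀ s t, s ≠ 0 → s ≠ 1 → γ₂ s ≠ γ₃ t) :
    (LeaveCounterclockwise γ₁ γ₂ γ₃ ∧ LeaveCounterclockwise γ₁.symm γ₃.symm γ₂.symm) ∨
    (LeaveCounterclockwise γ₁ γ₃ γ₂ ∧ LeaveCounterclockwise γ₁.symm γ₂.symm γ₃.symm) := by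
  have flip : ∀ {γ γ' : Path p q}, (∀ t, t ≠ 0 → t ≠ 1 → γ t ≠ p ∧ γ t ≠ q) →
      (∀ t, t ≠ 0 → t ≠ 1 → γ' t ≠ p ∧ γ' t ≠ q) → (∀ s t, s ≠ 0 → s ≠ 1 → γ s ≠ γ' t) →
      ∀ s t, s ≠ 0 → s ≠ 1 → γ' s ≠ γ t := by
    intro γ γ' i i' d s t h0 h1 h
    by_cases ht0 : t = 0
    · rw [ht0, γ.source] at h; exact (i' s h0 h1).1 h
    by_cases ht1 : t = 1
    · rw [ht1, γ.target] at h; exact (i' s h0 h1).2 h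
    exact d t s ht0 ht1 h.symm
  obtain ⟨C⟩ := nonempty_polarChart hpq
  obtain ⟨S₁⟩ := C.nonempty_strand γ₁ i₁
  obtain ⟨S₂⟩ := C.nonempty_strand γ₂ i₂
  obtain ⟨S₃⟩ := C.nonempty_strand γ₃ i₃
  have hd : 0 < min C.radius (dist p q) := lt_min C.radius_pos (dist_pos.2 hpq)
  obtain ⟨ρ, hρ0, hρ⟩ := exists_between hd
  have hr : ρ ≤ C.radius := hρ.le.trans (min_le_left _ _)
  have hr' : ρ < dist p q := hρ.trans_le (min_le_right _ _)
  have ex : ∀ γ : Path p q, ∃ t ∈ Ioo (0 : ℝ) 1, C.H (γ.extend t) = ρ ^ 2 / 2 - 1 ∧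
      ∀ r ∈ Ioo 0 t, C.H (γ.extend r) < C.H (γ.extend t) := fun γ => by
    obtain ⟨x, hx⟩ := exists_isFirstHit γ hρ0.le (by rw [dist_comm]; exact hr'.le)
    obtain ⟨t, ht, rfl, h⟩ := PolarChart.Strand.exists_of_firstHit hρ0 hr hr' hx
    exact ⟨t, ht, h⟩
  obtain ⟨t₁, m₁, e₁, f₁⟩ := ex γ₁
  obtain ⟨t₂, m₂, e₂, f₂⟩ := ex γ₂
  obtain ⟨t₃, m₃, e₃, f₃⟩ := ex γ₃
  obtain ⟨n, hn, hn'⟩ := S₁.exists_shift S₂ d₁₂ m₁ m₂ (e₁.trans e₂.symm)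
  obtain ⟨k, hk, hk'⟩ := S₁.exists_shift S₃ d₁₃ m₁ m₃ (e₁.trans e₃.symm)
  have d₂₁ := flip i₁ i₂ d₁₂
  have d₃₁ := flip i₁ i₃ d₁₃
  have d₃₂ := flip i₂ i₃ d₂₃
  rcases lt_trichotomy ((S₂.shift n).angle t₂) ((S₃.shift k).angle t₃) with h | h | h
  · left
    exact S₁.leave_of_lt hpq (S₂.shift n) (S₃.shift k) d₁₂ d₂₃ d₃₁
      ⟨m₁, m₂, e₁.trans e₂.symm, Or.inl ⟨f₁, f₂⟩⟩ ⟨m₂, m₃, e₂.trans e₃.symm, Or.inl ⟨f₂, f₃⟩⟩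
      ⟨m₃, m₁, e₃.trans e₁.symm, Or.inl ⟨f₃, f₁⟩⟩ hn h hk'
  · exact absurd h ((S₂.shift n).angle_ne (S₃.shift k) d₂₃ t₂ m₂ t₃ m₃ (e₂.trans e₃.symm))
  · right
    exact S₁.leave_of_lt hpq (S₃.shift k) (S₂.shift n) d₁₃ d₃₂ d₂₁
      ⟨m₁, m₃, e₁.trans e₃.symm, Or.inl ⟨f₁, f₃⟩⟩ ⟨m₃, m₂, e₃.trans e₂.symm, Or.inl ⟨f₃, f₂⟩⟩
      ⟨m₂, m₁, e₂.trans e₁.symm, Or.inl ⟨f₂, f₁⟩⟩ hk h hn'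

theorem isCounterclockwise_rotate {c x y z : S2} (h : IsCounterclockwise c x y z) :
    IsCounterclockwise c y z x := by
  unfold IsCounterclockwise at h ⊢
  rw [Matrix.det_fin_three] at h ⊢
  simp only [Matrix.of_apply, Matrix.cons_val] at h ⊢
  linarith

theorem not_isCounterclockwise_swap {c x y z : S2} (h : IsCounterclockwise c x y z) :
    ¬ IsCounterclockwise c x z y := by
  unfold IsCounterclockwise at h ⊢
  rw [Matrix.det_fin_three] at h ⊢
  simp only [Matrix.of_apply, Matrix.cons_val] at h ⊢
  linarith

namespace LeaveCounterclockwise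

variable {p a b c : S2} {α : Path p a} {β : Path p b} {δ : Path p c}

theorem rotate (h : LeaveCounterclockwise α β δ) : LeaveCounterclockwise β δ α :=
  h.mono fun _ ⟨x, y, z, hx, hy, hz, hc⟩ => ⟨y, z, x, hy, hz, hx, isCounterclockwise_rotate hc⟩

theorem not_swap (h : LeaveCounterclockwise α β δ) : ¬ LeaveCounterclockwise α δ β := by
  intro h'
  obtain ⟨ρ, ⟨x, y, z, hx, hy, hz, hc⟩, ⟨x', z', y', hx', hz', hy', hc'⟩⟩ := (h.and h').exists
  obtain rfl := hx.unique hx'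
  obtain rfl := hy.unique hy'
  obtain rfl := hz.unique hz'
  exact not_isCounterclockwise_swap hc hc'

end LeaveCounterclockwise

/-! ### From paths in the graph to curves on the sphere -/

/-- Two paths from a common point first reach every small circle at the same place. -/
def SameStart {p a b : S2} (α : Path p a) (β : Path p b) : Prop :=
  ∀ᶠ ρ : ℝ in 𝓝[>] 0, ∀ x, IsFirstHit α ρ x → IsFirstHit β ρ x

theorem SameStart.refl {p a : S2} (α : Path p a) : SameStart α α :=
  Eventually.of_forall fun _ _ h => h

theorem LeaveCounterclockwise.congr {p a b c a' b' c' : S2} {α : Path p a} {β : Path p b}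
    {δ : Path p c} {α' : Path p a'} {β' : Path p b'} {δ' : Path p c'}
    (h : LeaveCounterclockwise α β δ) (hα : SameStart α α') (hβ : SameStart β β')
    (hδ : SameStart δ δ') : LeaveCounterclockwise α' β' δ' := by
  filter_upwards [h, hα, hβ, hδ] with ρ ⟨x, y, z, hx, hy, hz, hc⟩ h1 h2 h3
  exact ⟨x, y, z, h1 x hx, h2 y hy, h3 z hz, hc⟩

/-- The first arc already reaches every circle of radius below `dist b a`, so the first hit happens
in the first half of the concatenation. -/
theorem sameStart_trans {a b c : S2} (hab : a ≠ b) (α : Path a b) (β : Path b c) :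
    SameStart (α.trans β) α := by
  filter_upwards [Ioo_mem_nhdsGT (dist_pos.2 hab.symm)] with ρ hρ x hx
  obtain ⟨y, t, rfl, hd, hlt⟩ := exists_isFirstHit α hρ.1.le hρ.2.le
  have half : ∀ s : unitInterval, (α.trans β).extend ((s : ℝ) / 2) = α s := by
    intro s
    rw [Path.extend_apply _ ⟨by linarith [s.2.1], by linarith [s.2.2]⟩, Path.trans_apply,
      dif_pos (show (s : ℝ) / 2 ≤ 1 / 2 by linarith [s.2.2])]
    congr 1
    ext
    show 2 * ((s : ℝ) / 2) = s
    ring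
  have hy : IsFirstHit (α.trans β) ρ (α t) := by
    have m : (t : ℝ) / 2 ∈ unitInterval := ⟨by linarith [t.2.1], by linarith [t.2.2]⟩
    refine ⟨⟨_, m⟩, ?_, hd, fun s hs => ?_⟩
    · rw [← half t, Path.extend_apply _ m]
    · have hs' : (s : ℝ) < t / 2 := hs
      have m' : 2 * (s : ℝ) ∈ unitInterval := ⟨by linarith [s.2.1], by linarith [t.2.2]⟩
      have := half ⟨_, m'⟩
      rw [show ((⟨2 * (s : ℝ), m'⟩ : unitInterval) : ℝ) / 2 = s by simp, Path.extend_apply _ s.2]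
        at this
      rw [show (α.trans β) s = _ from this]
      exact hlt _ (show 2 * (s : ℝ) < t by linarith)
  rw [hx.unique hy]
  exact ⟨t, rfl, hd, hlt⟩

namespace SphereEmbedding

variable {V : Type*} {G : SimpleGraph V} (em : SphereEmbedding G)

/-- A walk which is a path is realized by a curve, which starts and ends like the first and the
last arc, and at interior times meets interior vertices or the interior of edges of the walk. -/
theorem exists_curve {v u : V} (p : G.Walk v u) (hp : p.IsPath) (hvu : v ≠ u) :
    ∃ γ : Path (em.vert v) (em.vert u),
      (∀ t, t ≠ 0 → t ≠ 1 → (∃ w ∈ p.support, w ≠ v ∧ w ≠ u ∧ γ t = em.vert w) ∨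
        ∃ (x y : V) (h : G.Adj x y) (s : unitInterval), s(x, y) ∈ p.edges ∧ s ≠ 0 ∧ s ≠ 1 ∧
          γ t = em.arc h s) ∧
      (∀ a (h : G.Adj v a), a = p.snd → SameStart γ (em.arc h)) ∧
      (∀ a (h : G.Adj u a), a = p.penultimate → SameStart γ.symm (em.arc h)) := by
  induction p with
  | nil => exact absurd rfl hvu
  | @cons v w u h p ih =>
    rw [SimpleGraph.Walk.cons_isPath_iff] at hp
    by_cases hwu : w = u
    · subst hwu
      obtain rfl := (SimpleGraph.Walk.isPath_iff_nil.1 hp.1).eq_nil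
      refine ⟨em.arc h, fun t h0 h1 => Or.inr ⟨v, w, h, t, by simp, h0, h1, rfl⟩, ?_, ?_⟩
      · rintro a ha rfl; exact SameStart.refl _
      · rintro a ha rfl
        rw [← em.arc_symm]
        exact SameStart.refl _
    · obtain ⟨γ, h1, h2, h3⟩ := ih hp.1 hwu
      have hw : em.vert w ≠ em.vert u := fun e => hwu (em.vert_injective e)
      have hv : em.vert v ≠ em.vert w := fun e => h.ne (em.vert_injective e)
      refine ⟨(em.arc h).trans γ, fun t h0 h1' => ?_, ?_, ?_⟩
      · rw [Path.trans_apply]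
        split_ifs with ht
        · by_cases e : (⟨2 * (t : ℝ), (unitInterval.mul_pos_mem_iff zero_lt_two).2 ⟨t.2.1, ht⟩⟩ :
              unitInterval) = 1
          · left
            refine ⟨w, by simp, h.ne', hwu, ?_⟩
            rw [e, Path.target]
          · right
            refine ⟨v, w, h, _, by simp, ?_, e, rfl⟩
            intro e0
            apply h0
            have := congrArg Subtype.val e0
            ext
            simpa using this
        · have hs0 : (⟨2 * (t : ℝ) - 1, unitInterval.two_mul_sub_one_mem_iff.2
              ⟨(not_le.1 ht).le, t.2.2⟩⟩ : unitInterval) ≠ 0 := by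
            intro e0
            have := congrArg Subtype.val e0
            simp only [Icc.coe_zero] at this
            linarith [not_le.1 ht]
          have hs1 : (⟨2 * (t : ℝ) - 1, unitInterval.two_mul_sub_one_mem_iff.2
              ⟨(not_le.1 ht).le, t.2.2⟩⟩ : unitInterval) ≠ 1 := by
            intro e0
            apply h1'
            have := congrArg Subtype.val e0
            ext
            simp only [Icc.coe_one] at this ⊢
            linarith
          rcases h1 _ hs0 hs1 with ⟨z, hz, -, hzu, e⟩ | ⟨x, y, hxy, s, hm, hs⟩
          · left
            refine ⟨z, by simp [hz], ?_, hzu, e⟩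
            rintro rfl
            exact hp.2 hz
          · right
            exact ⟨x, y, hxy, s, by simp [hm], hs⟩
      · intro a ha e
        rw [SimpleGraph.Walk.snd_cons] at e
        subst e
        exact sameStart_trans hv _ _
      · intro a ha e
        have hnil : ¬ p.Nil := fun hn => hwu hn.eq
        rw [SimpleGraph.Walk.penultimate_cons_of_not_nil _ _ hnil] at e
        rw [Path.trans_symm]
        filter_upwards [sameStart_trans hw.symm γ.symm (em.arc h).symm, h3 a ha e] with ρ k1 k2 x hx
        exact k2 x (k1 x hx)

end SphereEmbedding

namespace SimpleGraph.Walk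

variable {V : Type*} {G : SimpleGraph V} {v u : V}

/-- Walks with common ends which meet only there, and take different first steps. -/
def InternallyDisjoint (p q : G.Walk v u) : Prop :=
  (∀ w ∈ p.support, w ∈ q.support → w = v ∨ w = u) ∧ p.snd ≠ q.snd

/-- Both ends of a common edge would be among `v` and `u`, so the edge would be `vu`. A path using
it starts with it, so the first steps would coincide. -/
theorem InternallyDisjoint.disjoint_edges {p q : G.Walk v u} (h : p.InternallyDisjoint q)
    (hp : p.IsPath) (hq : q.IsPath) {e : Sym2 V} (he : e ∈ p.edges) (he' : e ∈ q.edges) :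
    False := by
  induction e with
  | h x y =>
    have hx := h.1 x (p.fst_mem_support_of_mem_edges he) (q.fst_mem_support_of_mem_edges he')
    have hy := h.1 y (p.snd_mem_support_of_mem_edges he) (q.snd_mem_support_of_mem_edges he')
    have hxy := (p.adj_of_mem_edges he).ne
    have key : s(v, u) ∈ p.edges ∧ s(v, u) ∈ q.edges := by
      rcases hx with rfl | rfl <;> rcases hy with rfl | rfl
      · exact absurd rfl hxy
      · exact ⟨he, he'⟩
      · rw [Sym2.eq_swap]; exact ⟨he, he'⟩
      · exact absurd rfl hxy
    exact h.2 ((hp.eq_snd_of_mem_edges key.1).symm.trans (hq.eq_snd_of_mem_edges key.2))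

/-- Three paths with common ends which form a theta graph. -/
structure IsTheta (p q r : G.Walk v u) : Prop where
  ne : v ≠ u
  isPath₁ : p.IsPath
  isPath₂ : q.IsPath
  isPath₃ : r.IsPath
  disjoint₁₂ : p.InternallyDisjoint q
  disjoint₁₃ : p.InternallyDisjoint r
  disjoint₂₃ : q.InternallyDisjoint r

end SimpleGraph.Walk

namespace SphereEmbedding

variable {V : Type*} {G : SimpleGraph V} (em : SphereEmbedding G)

/-- The axioms of an embedding turn internally disjoint paths into arcs disjoint apart from their
ends. Each arc starts like the first and the last edge of its path, so the order of a theta curve is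
that of the half-edges. -/
theorem inducedOrder_theta {v u : V} {p q r : G.Walk v u} (hT : SimpleGraph.Walk.IsTheta p q r)
    {a b c : G.neighborSet v} {a' b' c' : G.neighborSet u} (ha : (a : V) = p.snd)
    (hb : (b : V) = q.snd) (hc : (c : V) = r.snd) (ha' : (a' : V) = p.penultimate)
    (hb' : (b' : V) = q.penultimate) (hc' : (c' : V) = r.penultimate) :
    (em.InducedOrder v a b c ∧ em.InducedOrder u a' c' b') ∨
      (em.InducedOrder v a c b ∧ em.InducedOrder u a' b' c') := by
  obtain ⟨α, α1, α2, α3⟩ := em.exists_curve p hT.isPath₁ hT.ne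
  obtain ⟨β, β1, β2, β3⟩ := em.exists_curve q hT.isPath₂ hT.ne
  obtain ⟨δ, δ1, δ2, δ3⟩ := em.exists_curve r hT.isPath₃ hT.ne
  have int : ∀ {p : G.Walk v u} {γ : Path (em.vert v) (em.vert u)},
      (∀ t, t ≠ 0 → t ≠ 1 → (∃ w ∈ p.support, w ≠ v ∧ w ≠ u ∧ γ t = em.vert w) ∨
        ∃ (x y : V) (h : G.Adj x y) (s : unitInterval), s(x, y) ∈ p.edges ∧ s ≠ 0 ∧ s ≠ 1 ∧
          γ t = em.arc h s) →
      ∀ t, t ≠ 0 → t ≠ 1 → γ t ≠ em.vert v ∧ γ t ≠ em.vert u := by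
    intro p γ h t h0 h1
    rcases h t h0 h1 with ⟨w, -, hv, hu, e⟩ | ⟨x, y, hxy, s, -, s0, s1, e⟩
    · rw [e]
      exact ⟨fun e => hv (em.vert_injective e), fun e => hu (em.vert_injective e)⟩
    · rw [e]
      exact ⟨fun e => (em.arc_ne_vert _ _ _ e).elim s0 s1,
        fun e => (em.arc_ne_vert _ _ _ e).elim s0 s1⟩
  have dis : ∀ {p q : G.Walk v u} {γ γ' : Path (em.vert v) (em.vert u)}, p.IsPath → q.IsPath →
      p.InternallyDisjoint q →
      (∀ t, t ≠ 0 → t ≠ 1 → (∃ w ∈ p.support, w ≠ v ∧ w ≠ u ∧ γ t = em.vert w) ∨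
        ∃ (x y : V) (h : G.Adj x y) (s : unitInterval), s(x, y) ∈ p.edges ∧ s ≠ 0 ∧ s ≠ 1 ∧
          γ t = em.arc h s) →
      (∀ t, t ≠ 0 → t ≠ 1 → (∃ w ∈ q.support, w ≠ v ∧ w ≠ u ∧ γ' t = em.vert w) ∨
        ∃ (x y : V) (h : G.Adj x y) (s : unitInterval), s(x, y) ∈ q.edges ∧ s ≠ 0 ∧ s ≠ 1 ∧
          γ' t = em.arc h s) →
      ∀ s t, s ≠ 0 → s ≠ 1 → γ s ≠ γ' t := by
    intro p q γ γ' hp hq hpq h h' s t s0 s1 e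
    by_cases t0 : t = 0
    · rw [t0, γ'.source] at e; exact (int h s s0 s1).1 e
    by_cases t1 : t = 1
    · rw [t1, γ'.target] at e; exact (int h s s0 s1).2 e
    rcases h s s0 s1 with ⟨w, hw, hv, hu, e1⟩ | ⟨x, y, hxy, k, hm, k0, k1, e1⟩ <;>
      rcases h' t t0 t1 with ⟨w', hw', hv', hu', e2⟩ | ⟨x', y', hxy', k', hm', k0', k1', e2⟩ <;>
      rw [e1, e2] at e
    · obtain rfl := em.vert_injective e
      exact (hpq.1 w hw hw').elim hv hu
    · exact (em.arc_ne_vert _ _ _ e.symm).elim k0' k1'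
    · exact (em.arc_ne_vert _ _ _ e).elim k0 k1
    · have := em.arc_disjoint _ _ _ _ k0 k1 e
      rw [← this] at hm'
      exact hpq.disjoint_edges hp hq hm hm'
  have hne : em.vert v ≠ em.vert u := fun e => hT.ne (em.vert_injective e)
  rcases leaveCounterclockwise_theta hne α β δ (int α1) (int β1) (int δ1)
    (dis hT.isPath₁ hT.isPath₂ hT.disjoint₁₂ α1 β1) (dis hT.isPath₁ hT.isPath₃ hT.disjoint₁₃ α1 δ1)
    (dis hT.isPath₂ hT.isPath₃ hT.disjoint₂₃ β1 δ1) with ⟨h1, h2⟩ | ⟨h1, h2⟩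
  -- `InducedOrder` unfolds to `LeaveCounterclockwise` for the three arcs.
  · exact Or.inl ⟨h1.congr (α2 a a.2 ha) (β2 b b.2 hb) (δ2 c c.2 hc),
      h2.congr (α3 a' a'.2 ha') (δ3 c' c'.2 hc') (β3 b' b'.2 hb')⟩
  · exact Or.inr ⟨h1.congr (α2 a a.2 ha) (δ2 c c.2 hc) (β2 b b.2 hb),
      h2.congr (α3 a' a'.2 ha') (β3 b' b'.2 hb') (δ3 c' c'.2 hc')⟩

theorem InducedOrder.rotate {em : SphereEmbedding G} {v : V} {a b c : G.neighborSet v}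
    (h : em.InducedOrder v a b c) : em.InducedOrder v b c a :=
  LeaveCounterclockwise.rotate h

theorem InducedOrder.not_swap {em : SphereEmbedding G} {v : V} {a b c : G.neighborSet v}
    (h : em.InducedOrder v a b c) : ¬ em.InducedOrder v a c b :=
  LeaveCounterclockwise.not_swap h

theorem InducedOrder.ne {em : SphereEmbedding G} {v : V} {a b c : G.neighborSet v}
    (h : em.InducedOrder v a b c) : a ≠ b ∧ b ≠ c ∧ a ≠ c := by
  refine ⟨?_, ?_, ?_⟩
  · rintro rfl; exact h.rotate.rotate.not_swap h.rotate.rotate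
  · rintro rfl; exact h.not_swap h
  · rintro rfl; exact h.rotate.not_swap h.rotate

theorem inducedOrder_mirror (v : V) (a b c : G.neighborSet v) :
    em.mirror.InducedOrder v a b c ↔ em.InducedOrder v a c b := by
  have hdist : ∀ x y : S2, dist (S2.reflect x) (S2.reflect y) = dist x y := by
    intro x y
    rw [Subtype.dist_eq, Subtype.dist_eq, EuclideanSpace.dist_eq, EuclideanSpace.dist_eq]
    simp only [Fin.sum_univ_three, Real.dist_eq, sq_abs, S2.reflect]
    congr 1
    simp
    ring
  have hfh : ∀ {u w : V} (h : G.Adj u w) (ρ : ℝ) (x : S2),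
      IsFirstHit (em.arc h) ρ x → IsFirstHit (em.mirror.arc h) ρ (S2.reflect x) := by
    rintro u w h ρ x ⟨t, rfl, hd, hlt⟩
    exact ⟨t, rfl, (hdist _ _).trans hd, fun s hs => (hdist _ _).trans_lt (hlt s hs)⟩
  have hfh' : ∀ {u w : V} (h : G.Adj u w) (ρ : ℝ) (x : S2),
      IsFirstHit (em.mirror.arc h) ρ x → ∃ y, IsFirstHit (em.arc h) ρ y ∧ S2.reflect y = x := by
    rintro u w h ρ x ⟨t, rfl, hd, hlt⟩
    exact ⟨em.arc h t, ⟨t, rfl, (hdist _ _).symm.trans hd,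
      fun s hs => (hdist _ _).symm.trans_lt (hlt s hs)⟩, rfl⟩
  have hccw : ∀ k x y z : S2, IsCounterclockwise (S2.reflect k) (S2.reflect x) (S2.reflect y)
      (S2.reflect z) ↔ IsCounterclockwise k x z y := by
    intro k x y z
    unfold IsCounterclockwise
    rw [Matrix.det_fin_three, Matrix.det_fin_three]
    simp only [Matrix.of_apply, Matrix.cons_val, S2.reflect]
    constructor <;> intro h <;> linarith
  constructor
  · intro h
    refine h.mono fun ρ => ?_
    rintro ⟨x, y, z, hx, hy, hz, hc⟩
    obtain ⟨x', hx', rfl⟩ := hfh' _ _ _ hx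
    obtain ⟨y', hy', rfl⟩ := hfh' _ _ _ hy
    obtain ⟨z', hz', rfl⟩ := hfh' _ _ _ hz
    exact ⟨x', z', y', hx', hz', hy', (hccw _ _ _ _).1 hc⟩
  · intro h
    refine h.mono fun ρ => ?_
    rintro ⟨x, z, y, hx, hz, hy, hc⟩
    exact ⟨_, _, _, hfh _ _ _ hx, hfh _ _ _ hy, hfh _ _ _ hz, (hccw _ _ _ _).2 hc⟩

end SphereEmbedding

/-! ### Menger's theorem for two walks -/

namespace SimpleGraph

variable {V : Type*}

/-- Menger's theorem for two disjoint walks. -/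
theorem exists_disjoint_walks [Finite V] [Nonempty V] (G : SimpleGraph V) (A B : Set V)
    (h : ∀ w, ∃ a ∈ A, ∃ b ∈ B, ∃ p : G.Walk a b, w ∉ p.support) :
    ∃ a ∈ A, ∃ b ∈ B, ∃ a' ∈ A, ∃ b' ∈ B, ∃ (p : G.Walk a b) (q : G.Walk a' b'),
      ∀ x ∈ p.support, x ∉ q.support := by
  classical
  induction hn : G.edgeSet.ncard using Nat.strong_induction_on generalizing G A B with
  | _ n ih =>
  subst hn
  by_cases hE : ∃ x y, G.Adj x y
  swap
  · push Not at hE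
    have triv : ∀ {a b : V}, G.Walk a b → a = b := by
      rintro a b (_ | ⟨h, _⟩)
      · rfl
      · exact absurd h (hE _ _)
    obtain ⟨w⟩ := ‹Nonempty V›
    obtain ⟨a, ha, b, hb, p, -⟩ := h w
    obtain rfl := triv p
    obtain ⟨a', ha', b', hb', p', hp'⟩ := h a
    obtain rfl := triv p'
    refine ⟨a, ha, a, hb, a', ha', a', hb', .nil, .nil, ?_⟩
    intro x hx hx'
    simp only [Walk.support_nil, List.mem_singleton] at hx hx'
    apply hp'
    rw [← hx, hx']
    exact p'.start_mem_support
  obtain ⟨x₀, y₀, hxy₀⟩ := hE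
  set G' := G.deleteEdges {s(x₀, y₀)} with hG'
  have hle : G' ≤ G := G.deleteEdges_le _
  have hcard : G'.edgeSet.ncard < G.edgeSet.ncard := by
    apply Set.ncard_lt_ncard _ (Set.toFinite _)
    rw [hG', edgeSet_deleteEdges]
    exact ⟨sdiff_subset, fun hs => (hs (show s(x₀, y₀) ∈ G.edgeSet from hxy₀)).2 rfl⟩
  by_cases h' : ∀ w, ∃ a ∈ A, ∃ b ∈ B, ∃ p : G'.Walk a b, w ∉ p.support
  · obtain ⟨a, ha, b, hb, a', ha', b', hb', p, q, hpq⟩ := ih _ hcard G' A B h' rfl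
    exact ⟨a, ha, b, hb, a', ha', b', hb', p.mapLe hle, q.mapLe hle, by simpa using hpq⟩
  push Not at h'
  -- Without the edge, the single vertex `w` separates `A` from `B`.
  obtain ⟨w, hw⟩ := h'
  have hadj : ∀ {z z'}, G.Adj z z' → s(z, z') ≠ s(x₀, y₀) → G'.Adj z z' := fun h1 h2 => by
    rw [hG', deleteEdges_adj]; exact ⟨h1, h2⟩
  have excl : ∀ z, (∃ a ∈ A, ∃ p : G'.Walk z a, w ∉ p.support) →
      (∃ b ∈ B, ∃ p : G'.Walk z b, w ∉ p.support) → False := by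
    rintro z ⟨a, ha, p, hp⟩ ⟨b, hb, q, hq⟩
    have := hw a ha b hb (p.reverse.append q)
    rw [Walk.mem_support_append_iff, Walk.support_reverse, List.mem_reverse] at this
    exact this.elim hp hq
  have last : ∀ (X : Set V) {z a : V} (p : G.Walk z a), a ∈ X → w ∉ p.support →
      (∃ b ∈ X, ∃ p : G'.Walk z b, w ∉ p.support) ∨
      (∃ b ∈ X, ∃ p : G'.Walk x₀ b, w ∉ p.support) ∨
      ∃ b ∈ X, ∃ p : G'.Walk y₀ b, w ∉ p.support := by
    intro X z a p ha hp
    induction p with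
    | nil => exact Or.inl ⟨_, ha, .nil, hp⟩
    | @cons z z' a hzz p ihp =>
      simp only [Walk.support_cons, List.mem_cons, not_or] at hp
      rcases ihp ha hp.2 with ⟨b, hb, q, hq⟩ | h1
      · by_cases he : s(z, z') = s(x₀, y₀)
        · rcases Sym2.eq_iff.1 he with ⟨-, rfl⟩ | ⟨-, rfl⟩
          · exact Or.inr (Or.inr ⟨b, hb, q, hq⟩)
          · exact Or.inr (Or.inl ⟨b, hb, q, hq⟩)
        · exact Or.inl ⟨b, hb, .cons (hadj hzz he) q, by simp [hp.1, hq]⟩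
      · exact Or.inr h1
  -- A walk from `A` to `B` avoiding `w` must use the deleted edge. Off `w`, one end `x` of it is
  -- therefore on the side of `A` and the other end `y` on the side of `B`.
  obtain ⟨x, y, he, hx, hy⟩ : ∃ x y, s(x, y) = s(x₀, y₀) ∧
      (∃ a ∈ A, ∃ p : G'.Walk x a, w ∉ p.support) ∧
      ∃ b ∈ B, ∃ p : G'.Walk y b, w ∉ p.support := by
    obtain ⟨a, ha, b, hb, p, hp⟩ := h w
    have hwa : w ≠ a := fun e => hp (e ▸ p.start_mem_support)
    have hwb : w ≠ b := fun e => hp (e ▸ p.end_mem_support)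
    have ra : ∃ c ∈ A, ∃ p : G'.Walk a c, w ∉ p.support := ⟨a, ha, .nil, by simpa using hwa⟩
    have rb : ∃ c ∈ B, ∃ p : G'.Walk b c, w ∉ p.support := ⟨b, hb, .nil, by simpa using hwb⟩
    have h1 := (last B p hb hp).resolve_left (excl a ra)
    have h2 := (last A p.reverse ha (by simpa using hp)).resolve_left fun h => excl b h rb
    rcases h1 with h1 | h1 <;> rcases h2 with h2 | h2
    · exact absurd h1 (excl _ h2)
    · exact ⟨y₀, x₀, Sym2.eq_swap, h2, h1⟩
    · exact ⟨x₀, y₀, rfl, h2, h1⟩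
    · exact absurd h1 (excl _ h2)
  have hxy : G.Adj x y := by
    have : s(x, y) ∈ G.edgeSet := he ▸ hxy₀
    exact this
  -- No single vertex separates `A` from `{w, x}` in `G'`: a walk towards `B`, stopped at the
  -- deleted edge, reaches `w` or `x`, because reaching `y` or `B` off `w` would contradict the
  -- choice of `w`. Induction gives disjoint walks from `A` to `w` and to `x`.
  have half : ∀ (A B : Set V) (x y : V), s(x, y) = s(x₀, y₀) →
      (∀ u, ∃ a ∈ A, ∃ b ∈ B, ∃ p : G.Walk a b, u ∉ p.support) →
      (∀ a ∈ A, ∀ b ∈ B, ∀ p : G'.Walk a b, w ∈ p.support) →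
      (∃ b ∈ B, ∃ p : G'.Walk y b, w ∉ p.support) →
      ∃ a ∈ A, ∃ a' ∈ A, ∃ (p : G'.Walk a w) (q : G'.Walk a' x), p.IsPath ∧
        ∀ z ∈ p.support, z ∉ q.support := by
    intro A B x y he h hw hy
    have toHit : ∀ u, ∀ {z b : V} (p : G.Walk z b), u ∉ p.support →
        ∃ c, (c = w ∨ c = x ∨ c = y ∨ c = b) ∧ ∃ q : G'.Walk z c, u ∉ q.support := by
      intro u z b p hp
      induction p with
      | nil => exact ⟨_, by tauto, .nil, hp⟩
      | @cons z z' b hzz p ihp =>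
        by_cases hz : z = x ∨ z = y
        · exact ⟨z, by tauto, .nil, by simp at hp ⊢; tauto⟩
        · simp only [Walk.support_cons, List.mem_cons, not_or] at hp
          obtain ⟨c, hc, q, hq⟩ := ihp hp.2
          refine ⟨c, hc, .cons (hadj hzz fun e => hz ?_) q, by simp [hp.1, hq]⟩
          rw [← he] at e
          rcases Sym2.eq_iff.1 e with ⟨h, -⟩ | ⟨h, -⟩ <;> tauto
    have hyp : ∀ u, ∃ a ∈ A, ∃ b ∈ ({w, x} : Set V), ∃ p : G'.Walk a b, u ∉ p.support := by
      intro u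
      obtain ⟨a, ha, b, hb, p, hp⟩ := h u
      obtain ⟨c, hc, q, hq⟩ := toHit u p hp
      by_cases hwq : w ∈ q.support
      · exact ⟨a, ha, w, by simp, q.takeUntil w hwq,
          fun hu => hq (q.support_takeUntil_subset_support hwq hu)⟩
      · rcases hc with rfl | rfl | rfl | rfl
        · exact absurd q.end_mem_support hwq
        · exact ⟨a, ha, c, by simp, q, hq⟩
        · obtain ⟨b', hb', q', hq'⟩ := hy
          have := hw a ha b' hb' (q.append q')
          rw [Walk.mem_support_append_iff] at this
          exact absurd this (by tauto)
        · exact absurd (hw a ha c hb q) hwq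
    obtain ⟨a, ha, b, hb, a', ha', b', hb', p, q, hpq⟩ := ih _ hcard G' A {w, x} hyp rfl
    have hne : b ≠ b' := fun e => hpq b p.end_mem_support (e ▸ q.end_mem_support)
    rcases hb with rfl | rfl <;> rcases hb' with rfl | rfl
    · exact absurd rfl hne
    · exact ⟨a, ha, a', ha', p.bypass, q, p.bypass_isPath,
        fun z hz => hpq z (p.support_bypass_subset_support hz)⟩
    · exact ⟨a', ha', a, ha, q.bypass, p, q.bypass_isPath,
        fun z hz hz' => hpq z hz' (q.support_bypass_subset_support hz)⟩
    · exact absurd rfl hne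
  obtain ⟨a, ha, a', ha', p, q, hp, hpq⟩ := half A B x y he h hw hy
  obtain ⟨b, hb, b', hb', r, s, hr, hrs⟩ := half B A y x (Sym2.eq_swap.trans he)
    (fun u => by
      obtain ⟨a, ha, b, hb, p, hp⟩ := h u
      exact ⟨b, hb, a, ha, p.reverse, by simpa using hp⟩)
    (fun b hb a ha p => by simpa using hw a ha b hb p.reverse) hx
  -- Every vertex other than `w` on the four half-walks reaches its own side off `w`, so halves from
  -- different sides can meet only at `w`. They are glued at `w` and along the edge `xy`.
  have toA : ∀ {X : Set V} {c : V} (k : G'.Walk c w), k.IsPath → c ∈ X → ∀ z ∈ k.support, z ≠ w →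
      ∃ b ∈ X, ∃ p : G'.Walk z b, w ∉ p.support := fun {X c} k hk hc z hz hzw =>
    ⟨c, hc, (k.takeUntil z hz).reverse, by
      simpa using Walk.endpoint_notMem_support_takeUntil hk hz hzw.symm⟩
  have toB : ∀ {X : Set V} {c d : V} (k : G'.Walk c d), w ∉ k.support → c ∈ X → ∀ z ∈ k.support,
      ∃ b ∈ X, ∃ p : G'.Walk z b, w ∉ p.support := fun {X c d} k hk hc z hz =>
    ⟨c, hc, (k.takeUntil z hz).reverse, by
      simpa using fun h => hk (k.support_takeUntil_subset_support hz h)⟩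
  have hwq : w ∉ q.support := hpq w p.end_mem_support
  have hws : w ∉ s.support := hrs w r.end_mem_support
  refine ⟨a, ha, b, hb, a', ha', b', hb', (p.append r.reverse).mapLe hle,
    (q.mapLe hle).append (.cons hxy (s.reverse.mapLe hle)), ?_⟩
  intro z hz hz'
  simp only [Walk.support_mapLe_eq_support, Walk.mem_support_append_iff, Walk.support_reverse,
    List.mem_reverse, Walk.support_cons, List.mem_cons] at hz hz'
  have hz'' : z ∈ q.support ∨ z ∈ s.support := by
    rcases hz' with h | rfl | h
    · exact Or.inl h
    · exact Or.inl q.end_mem_support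
    · exact Or.inr h
  rcases hz with hz | hz <;> rcases hz'' with hz' | hz'
  · exact hpq z hz hz'
  · exact excl z (toA p hp ha z hz (fun e => hws (e ▸ hz'))) (toB s hws hb' z hz')
  · exact excl z (toB q hwq ha' z hz') (toA r hr hb z hz (fun e => hwq (e ▸ hz')))
  · exact hrs z hz hz'

theorem exists_walk_of_induce {G : SimpleGraph V} {s : Set V} {a b : s}
    (p : (G.induce s).Walk a b) :
    ∃ q : G.Walk a.1 b.1, ∀ z ∈ q.support, ∃ h : z ∈ s, (⟨z, h⟩ : s) ∈ p.support := by
  induction p with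
  | @nil u =>
    refine ⟨.nil, fun z hz => ?_⟩
    obtain rfl : z = u.1 := by simpa using hz
    exact ⟨u.2, by simp⟩
  | @cons u _ _ h p ih =>
    obtain ⟨q, hq⟩ := ih
    refine ⟨.cons (induce_adj.1 h) q, fun z hz => ?_⟩
    rw [Walk.support_cons, List.mem_cons] at hz
    rcases hz with rfl | hz
    · exact ⟨u.2, by simp⟩
    · obtain ⟨h1, h2⟩ := hq z hz
      exact ⟨h1, by simp [h2]⟩

/-- Menger's theorem for two disjoint walks outside a given set of vertices. -/
theorem exists_disjoint_walks_avoiding [Finite V] (G : SimpleGraph V) (S A B : Set V)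
    (hS : ∃ x, x ∉ S)
    (h : ∀ w, w ∉ S → ∃ a ∈ A, ∃ b ∈ B, ∃ p : G.Walk a b, w ∉ p.support ∧ ∀ z ∈ p.support, z ∉ S) :
    ∃ a ∈ A, ∃ b ∈ B, ∃ a' ∈ A, ∃ b' ∈ B, ∃ (p : G.Walk a b) (q : G.Walk a' b'),
      (∀ z ∈ p.support, z ∉ S) ∧ (∀ z ∈ q.support, z ∉ S) ∧ ∀ x ∈ p.support, x ∉ q.support := by
  obtain ⟨x, hx⟩ := hS
  have : Nonempty (Sᶜ : Set V) := ⟨⟨x, hx⟩⟩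
  obtain ⟨a, ha, b, hb, a', ha', b', hb', p, q, hpq⟩ := exists_disjoint_walks (G.induce Sᶜ)
    (Subtype.val ⁻¹' A) (Subtype.val ⁻¹' B) (by
      rintro ⟨w, hw⟩
      obtain ⟨a, ha, b, hb, p, hp, hpS⟩ := h w hw
      refine ⟨⟨a, hpS a p.start_mem_support⟩, ha, ⟨b, hpS b p.end_mem_support⟩, hb,
        p.induce Sᶜ hpS, ?_⟩
      intro hmem
      rw [Walk.support_induce] at hmem
      apply hp
      simpa using hmem)
  obtain ⟨p', hp'⟩ := exists_walk_of_induce p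
  obtain ⟨q', hq'⟩ := exists_walk_of_induce q
  refine ⟨a, ha, b, hb, a', ha', b', hb', p', q', fun z hz => (hp' z hz).1,
    fun z hz => (hq' z hz).1, fun z hz hz' => ?_⟩
  exact hpq _ (hp' z hz).2 (hq' z hz').2

theorem IsVertexConnected.exists_walk {G : SimpleGraph V} {k : ℕ} (hG : G.IsVertexConnected k)
    {T : Set V} (hT : T.ncard < k) {a b : V} (ha : a ∉ T) (hb : b ∉ T) :
    ∃ p : G.Walk a b, ∀ z ∈ p.support, z ∉ T := by
  obtain ⟨p⟩ := (hG.2.2 T hT).preconnected ⟨a, ha⟩ ⟨b, hb⟩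
  obtain ⟨q, hq⟩ := exists_walk_of_induce p
  exact ⟨q, fun z hz => (hq z hz).1⟩

end SimpleGraph

/-! ### Tripods and theta graphs in a 3-connected graph -/

namespace SimpleGraph

variable {V : Type*} {G : SimpleGraph V}

theorem Walk.internallyDisjoint_concat {v x a b : V} {p : G.Walk x a} {q : G.Walk x b}
    (ha : G.Adj a v) (hb : G.Adj b v) (hp : p.IsPath) (hq : q.IsPath) (hvp : v ∉ p.support)
    (hvq : v ∉ q.support) (hpq : ∀ z ∈ p.support, z ∈ q.support → z = x) (hab : a ≠ b) :
    (p.concat ha).InternallyDisjoint (q.concat hb) := by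
  constructor
  · intro w hw hw'
    rw [Walk.support_concat, List.mem_append, List.mem_singleton] at hw hw'
    rcases hw with hw | hw
    · rcases hw' with hw' | hw'
      · exact Or.inl (hpq w hw hw')
      · exact Or.inr hw'
    · exact Or.inr hw
  · intro e
    cases p with
    | nil =>
      cases q with
      | nil => exact hab rfl
      | cons h q =>
        apply hvq
        simp only [Walk.concat_nil, Walk.concat_cons, Walk.snd_cons] at e
        rw [e]
        simp
    | @cons _ y _ h p =>
      cases q with
      | nil =>
        apply hvp
        simp only [Walk.concat_nil, Walk.concat_cons, Walk.snd_cons] at e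
        rw [← e]
        simp
      | cons h' q =>
        simp only [Walk.concat_cons, Walk.snd_cons] at e
        subst e
        exact h.ne' (hpq y (by simp) (by simp))

/-- Three paths from `x` to neighbours of `v` which meet only at `x` and avoid `v` extend to a theta
graph. -/
theorem Walk.isTheta_concat {v x a b c : V} {p : G.Walk x a} {q : G.Walk x b} {r : G.Walk x c}
    (ha : G.Adj a v) (hb : G.Adj b v) (hc : G.Adj c v) (hp : p.IsPath) (hq : q.IsPath)
    (hr : r.IsPath) (hvp : v ∉ p.support) (hvq : v ∉ q.support) (hvr : v ∉ r.support)
    (hpq : ∀ z ∈ p.support, z ∈ q.support → z = x) (hpr : ∀ z ∈ p.support, z ∈ r.support → z = x)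
    (hqr : ∀ z ∈ q.support, z ∈ r.support → z = x) (hab : a ≠ b) (hac : a ≠ c) (hbc : b ≠ c) :
    Walk.IsTheta (p.concat ha) (q.concat hb) (r.concat hc) where
  ne := fun e => hvp (e ▸ p.start_mem_support)
  isPath₁ := hp.concat hvp ha
  isPath₂ := hq.concat hvq hb
  isPath₃ := hr.concat hvr hc
  disjoint₁₂ := Walk.internallyDisjoint_concat ha hb hp hq hvp hvq hpq hab
  disjoint₁₃ := Walk.internallyDisjoint_concat ha hc hp hr hvp hvr hpr hac
  disjoint₂₃ := Walk.internallyDisjoint_concat hb hc hq hr hvq hvr hqr hbc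

/-- A property of tripods which does not depend on the order of the legs, and is shared by the two
tripods of each theta graph. -/
structure IsThetaInvariant (G : SimpleGraph V) (Q : V → V → V → V → Prop) : Prop where
  swap : ∀ {v a b c}, Q v a b c → Q v b a c
  rotate : ∀ {v a b c}, Q v a b c → Q v b c a
  theta : ∀ {v u : V} {p q r : G.Walk v u}, Walk.IsTheta p q r →
    (Q v p.snd q.snd r.snd ↔ Q u p.penultimate q.penultimate r.penultimate)

/-- Three distinct neighbours. -/
structure IsTripod (G : SimpleGraph V) (v a b c : V) : Prop where
  adj₁ : G.Adj v a
  adj₂ : G.Adj v b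
  adj₃ : G.Adj v c
  ne₁₂ : a ≠ b
  ne₁₃ : a ≠ c
  ne₂₃ : b ≠ c

/-- Disjoint walks join `a` to `b` and `c` to `d` outside `v`. -/
def IsLinked (G : SimpleGraph V) (v a b c d : V) : Prop :=
  ∃ (p : G.Walk a b) (q : G.Walk c d), v ∉ p.support ∧ v ∉ q.support ∧
    ∀ z ∈ p.support, z ∉ q.support

theorem IsLinked.reverse {v a b c d : V} (h : G.IsLinked v a b c d) : G.IsLinked v a b d c := by
  obtain ⟨p, q, hp, hq, hpq⟩ := h
  exact ⟨p, q.reverse, hp, by simpa using hq, by simpa using hpq⟩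

namespace IsThetaInvariant

variable {Q : V → V → V → V → Prop}

theorem swap_iff (hQ : G.IsThetaInvariant Q) {v a b c : V} : Q v a b c ↔ Q v b a c :=
  ⟨hQ.swap, hQ.swap⟩

theorem rotate_iff (hQ : G.IsThetaInvariant Q) {v a b c : V} : Q v a b c ↔ Q v b c a :=
  ⟨hQ.rotate, fun h => hQ.rotate (hQ.rotate h)⟩

theorem swap_right_iff (hQ : G.IsThetaInvariant Q) {v a b c : V} : Q v a b c ↔ Q v a c b :=
  hQ.rotate_iff.trans (hQ.swap_iff.trans (hQ.rotate_iff.trans hQ.rotate_iff))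

/-- Connect `c`, off `v`, to a vertex `x` of the path from `a` to `b`. This gives a theta with
branch points `x` and `v` and last steps `a`, `b`, `c`. Continuing the third leg from `c` to `d`
gives another one, with the same tripod at `x`. -/
theorem iff_of_isLinked (hQ : G.IsThetaInvariant Q) (hG : G.IsVertexConnected 3) {v a b c d : V}
    (h : G.IsTripod v a b c) (h' : G.IsTripod v a b d) (hl : G.IsLinked v a b c d) :
    Q v a b c ↔ Q v a b d := by
  classical
  obtain ⟨p₀, r, hvp₀, hvr, hpr₀⟩ := hl
  obtain ⟨p, hp, hvp, hpr⟩ : ∃ p : G.Walk a b, p.IsPath ∧ v ∉ p.support ∧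
      ∀ z ∈ p.support, z ∉ r.support :=
    ⟨p₀.bypass, p₀.bypass_isPath, fun h => hvp₀ (p₀.support_bypass_subset_support h),
      fun z hz => hpr₀ z (p₀.support_bypass_subset_support hz)⟩
  obtain ⟨k, hk⟩ := hG.exists_walk (T := {v}) (by simp) (a := c) (b := a)
    (by simpa using h.adj₃.ne') (by simpa using h.adj₁.ne')
  -- Follows `k` to its first vertex on `p`, carrying along a walk back to `c` which misses `p` and
  -- `v`.
  have cross : ∀ {z a' : V} (k : G.Walk z a'), a' ∈ p.support → v ∉ k.support →
      (∃ w : G.Walk z c, v ∉ w.support ∧ ∀ y ∈ w.support, y ∉ p.support) →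
      ∃ x y, x ∈ p.support ∧ G.Adj x y ∧
        ∃ w : G.Walk y c, v ∉ w.support ∧ ∀ y ∈ w.support, y ∉ p.support := by
    intro z a' k ha' hv hz
    induction k with
    | nil =>
      obtain ⟨w, -, hw⟩ := hz
      exact absurd ha' (hw _ w.start_mem_support)
    | @cons z z' a' e k ih =>
      by_cases hz' : z' ∈ p.support
      · exact ⟨z', z, hz', e.symm, hz⟩
      · simp only [Walk.support_cons, List.mem_cons, not_or] at hv
        refine ih ha' hv.2 ?_
        obtain ⟨w, hw, hw'⟩ := hz
        refine ⟨.cons e.symm w, ?_, ?_⟩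
        · have : v ≠ z' := fun e => hv.2 (e ▸ k.start_mem_support)
          simp [this, hw]
        · intro y hy
          rw [Walk.support_cons, List.mem_cons] at hy
          rcases hy with rfl | hy
          · exact hz'
          · exact hw' y hy
  obtain ⟨x, y, hx, hxy, w, hvw, hw⟩ := cross k p.start_mem_support (fun h => hk v h rfl)
    ⟨.nil, by simpa using h.adj₃.ne, by
      intro y hy hy'
      obtain rfl : y = c := by simpa using hy
      exact hpr y hy' r.start_mem_support⟩
  have hvx : v ≠ x := fun e => hvp (e ▸ hx)
  have hab : ∀ z ∈ (p.takeUntil x hx).reverse.support, z ∈ (p.dropUntil x hx).support →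
      z = x := by
    intro z hz hz'
    by_contra hzx
    rw [Walk.support_reverse, List.mem_reverse] at hz
    have h1 : z ∈ (p.dropUntil x hx).support.tail := by
      rw [Walk.mem_support_iff] at hz'
      exact hz'.resolve_left hzx
    have h2 := hp.support_nodup
    rw [← p.take_spec hx, Walk.support_append] at h2
    exact (List.disjoint_of_nodup_append h2) hz h1
  have third : ∀ {e : V} (s : G.Walk y e), G.IsTripod v a b e → v ∉ s.support →
      (∀ z ∈ s.support, z ∉ p.support) →
      (Q x ((p.takeUntil x hx).reverse.concat h.adj₁.symm).snd
        ((p.dropUntil x hx).concat h.adj₂.symm).snd y ↔ Q v a b e) := by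
    intro e s he hvs hs
    have hs' : ∀ z ∈ s.bypass.support, z ∉ p.support :=
      fun z hz => hs z (s.support_bypass_subset_support hz)
    have hT := Walk.isTheta_concat h.adj₁.symm h.adj₂.symm he.adj₃.symm
      (p := (p.takeUntil x hx).reverse) (q := p.dropUntil x hx) (r := .cons hxy s.bypass)
      (hp.takeUntil hx).reverse (hp.dropUntil hx)
      (Walk.cons_isPath_iff _ _ |>.2 ⟨s.bypass_isPath, fun h => hs' x h hx⟩)
      (by simpa using fun h => hvp (p.support_takeUntil_subset_support hx h))
      (fun h => hvp (p.support_dropUntil_subset_support hx h))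
      (by simpa [hvx] using fun h => hvs (s.support_bypass_subset_support h)) hab
      (by
        intro z hz hz'
        rw [Walk.support_reverse, List.mem_reverse] at hz
        rw [Walk.support_cons, List.mem_cons] at hz'
        exact hz'.resolve_right fun h => hs' z h (p.support_takeUntil_subset_support hx hz))
      (by
        intro z hz hz'
        rw [Walk.support_cons, List.mem_cons] at hz'
        exact hz'.resolve_right fun h => hs' z h (p.support_dropUntil_subset_support hx hz))
      he.ne₁₂ he.ne₁₃ he.ne₂₃
    have := hQ.theta hT
    rwa [Walk.penultimate_concat, Walk.penultimate_concat, Walk.penultimate_concat,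
      Walk.concat_cons, Walk.snd_cons] at this
  refine (third w h hvw hw).symm.trans (third (w.append r) h' ?_ ?_)
  · rw [Walk.mem_support_append_iff]
    exact fun h => h.elim hvw hvr
  · intro z hz hz'
    rw [Walk.mem_support_append_iff] at hz
    exact hz.elim (fun h => hw z h hz') (hpr z hz')

end IsThetaInvariant

/-- Menger's theorem in `G` minus `v`, between `{a, b}` and `{c, d}`: removing one more vertex
leaves a connected graph, and two disjoint walks realize one of the two matchings. -/
theorem IsVertexConnected.isLinked_or (hG : G.IsVertexConnected 3) {v a b c d : V} (ha : v ≠ a)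
    (hb : v ≠ b) (hc : v ≠ c) (hd : v ≠ d) (hab : a ≠ b) (hcd : c ≠ d) :
    G.IsLinked v a c b d ∨ G.IsLinked v a d b c := by
  have := hG.1
  obtain ⟨x, hx, y, hy, x', hx', y', hy', p, q, hp, hq, hpq⟩ :=
    exists_disjoint_walks_avoiding G {v} {a, b} {c, d} ⟨a, by simpa using ha.symm⟩ (by
      intro w hw
      have hvw : w ≠ v := by simpa using hw
      obtain ⟨x, hx, hxw⟩ : ∃ x ∈ ({a, b} : Set V), x ≠ w := by
        by_cases e : a = w
        · exact ⟨b, by simp, fun e' => hab (e.trans e'.symm)⟩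
        · exact ⟨a, by simp, e⟩
      obtain ⟨y, hy, hyw⟩ : ∃ y ∈ ({c, d} : Set V), y ≠ w := by
        by_cases e : c = w
        · exact ⟨d, by simp, fun e' => hcd (e.trans e'.symm)⟩
        · exact ⟨c, by simp, e⟩
      have hxv : x ≠ v := by rcases hx with rfl | rfl <;> exact Ne.symm ‹_›
      have hyv : y ≠ v := by rcases hy with rfl | rfl <;> exact Ne.symm ‹_›
      obtain ⟨p, hp⟩ := hG.exists_walk (T := {w, v}) (by rw [Set.ncard_pair hvw]; norm_num)
        (a := x) (b := y) (by simp [hxw, hxv]) (by simp [hyw, hyv])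
      exact ⟨x, hx, y, hy, p, fun h => hp w h (by simp),
        fun z hz hz' => hp z hz (by simp [mem_singleton_iff.1 hz'])⟩)
  have hvp : v ∉ p.support := fun h => hp v h rfl
  have hvq : v ∉ q.support := fun h => hq v h rfl
  have hqp : ∀ z ∈ q.support, z ∉ p.support := fun z hz hz' => hpq z hz' hz
  have hxx : x ≠ x' := fun e => hpq x p.start_mem_support (e ▸ q.start_mem_support)
  have hyy : y ≠ y' := fun e => hpq y p.end_mem_support (e ▸ q.end_mem_support)
  rcases hx with rfl | rfl <;> rcases hx' with rfl | rfl <;> rcases hy with rfl | rfl <;>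
    rcases hy' with rfl | rfl
  all_goals first
    | exact absurd rfl hxx
    | exact absurd rfl hyy
    | exact Or.inl ⟨p, q, hvp, hvq, hpq⟩
    | exact Or.inr ⟨p, q, hvp, hvq, hpq⟩
    | exact Or.inl ⟨q, p, hvq, hvp, hqp⟩
    | exact Or.inr ⟨q, p, hvq, hvp, hqp⟩

namespace IsTripod

theorem swap {v a b c : V} (h : G.IsTripod v a b c) : G.IsTripod v b a c :=
  ⟨h.adj₂, h.adj₁, h.adj₃, h.ne₁₂.symm, h.ne₂₃, h.ne₁₃⟩

theorem rotate {v a b c : V} (h : G.IsTripod v a b c) : G.IsTripod v b c a :=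
  ⟨h.adj₂, h.adj₃, h.adj₁, h.ne₂₃, h.ne₁₂.symm, h.ne₁₃.symm⟩

end IsTripod

namespace IsThetaInvariant

variable {Q : V → V → V → V → Prop}

/-- Of the three pairings of `a`, `b`, `c`, `d`, either `ab|cd` is linked, and `c` is exchanged for
`d` at once, or both `ac|bd` and `ad|bc` are. In the second case one goes from `abc` through `acd`
to `abd`. -/
theorem iff_exchange (hQ : G.IsThetaInvariant Q) (hG : G.IsVertexConnected 3) {v a b c d : V}
    (h : G.IsTripod v a b c) (h' : G.IsTripod v a b d) : Q v a b c ↔ Q v a b d := by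
  by_cases hcd : c = d
  · rw [hcd]
  have acd : G.IsTripod v a c d := ⟨h.adj₁, h.adj₃, h'.adj₃, h.ne₁₃, h'.ne₁₃, hcd⟩
  have m₂ := hG.isLinked_or h.adj₁.ne h.adj₃.ne h.adj₂.ne h'.adj₃.ne h.ne₁₃ h'.ne₂₃
  have m₃ := hG.isLinked_or h.adj₁.ne h'.adj₃.ne h.adj₂.ne h.adj₃.ne h'.ne₁₃ h.ne₂₃
  rcases m₂ with m₂ | m₂
  · exact hQ.iff_of_isLinked hG h h' m₂
  rcases m₃ with m₃ | m₃
  · exact hQ.iff_of_isLinked hG h h' m₃.reverse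
  have e₁ : Q v a c b ↔ Q v a c d :=
    hQ.iff_of_isLinked hG h.rotate.rotate.swap acd m₃.reverse
  have e₂ : Q v a d b ↔ Q v a d c :=
    hQ.iff_of_isLinked hG h'.rotate.rotate.swap acd.rotate.rotate.swap m₂.reverse
  exact hQ.swap_right_iff.trans (e₁.trans (hQ.swap_right_iff.trans
    (e₂.symm.trans hQ.swap_right_iff)))

/-- The legs `a'`, `b'`, `c'` are brought in one after the other, each by one exchange unless it is
already present. -/
theorem iff_of_same_center (hQ : G.IsThetaInvariant Q) (hG : G.IsVertexConnected 3)
    {v a b c a' b' c' : V} (h : G.IsTripod v a b c) (h' : G.IsTripod v a' b' c') :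
    Q v a b c ↔ Q v a' b' c' := by
  obtain ⟨y, z, h₁, e₁⟩ : ∃ y z, G.IsTripod v a' y z ∧ (Q v a b c ↔ Q v a' y z) := by
    by_cases ha : a' = a
    · exact ⟨b, c, ha ▸ h, ha ▸ Iff.rfl⟩
    by_cases hb : a' = b
    · exact ⟨c, a, hb ▸ h.rotate, hb ▸ hQ.rotate_iff⟩
    by_cases hc : a' = c
    · exact ⟨a, b, hc ▸ h.rotate.rotate, hc ▸ hQ.rotate_iff.trans hQ.rotate_iff⟩
    have k : G.IsTripod v b c a' := ⟨h.adj₂, h.adj₃, h'.adj₁, h.ne₂₃, Ne.symm hb, Ne.symm hc⟩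
    exact ⟨b, c, k.rotate.rotate, hQ.rotate_iff.trans ((hQ.iff_exchange hG h.rotate k).trans
      (hQ.rotate_iff.trans hQ.rotate_iff))⟩
  obtain ⟨w, h₂, e₂⟩ : ∃ w, G.IsTripod v a' b' w ∧ (Q v a' y z ↔ Q v a' b' w) := by
    by_cases hy : b' = y
    · exact ⟨z, hy ▸ h₁, hy ▸ Iff.rfl⟩
    by_cases hz : b' = z
    · exact ⟨y, hz ▸ h₁.rotate.rotate.swap, hz ▸ hQ.swap_right_iff⟩
    have k : G.IsTripod v z a' b' :=
      ⟨h₁.adj₃, h'.adj₁, h'.adj₂, h₁.ne₁₃.symm, Ne.symm hz, h'.ne₁₂⟩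
    exact ⟨z, k.rotate, hQ.rotate_iff.trans (hQ.rotate_iff.trans
      ((hQ.iff_exchange hG h₁.rotate.rotate k).trans hQ.rotate_iff))⟩
  exact e₁.trans (e₂.trans (hQ.iff_exchange hG h₂ h'))

end IsThetaInvariant

theorem IsVertexConnected.exists_notMem (hG : G.IsVertexConnected 3) {T : Set V}
    (hT : T.ncard ≤ 3) : ∃ x, x ∉ T := by
  by_contra h
  push Not at h
  have := hG.2.1
  rw [← Set.ncard_univ, ← Set.eq_univ_of_forall h] at this
  omega

/-- The ends of an edge are the branch points of a theta graph. -/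
theorem IsVertexConnected.exists_isTheta (hG : G.IsVertexConnected 3) {u v : V} (h : G.Adj u v) :
    ∃ p q r : G.Walk u v, Walk.IsTheta p q r := by
  classical
  have := hG.1
  obtain ⟨a, ha, b, hb, a', ha', b', hb', p, q, hp, hq, hpq⟩ :=
    exists_disjoint_walks_avoiding G {u, v} {x | G.Adj u x ∧ x ≠ v} {x | G.Adj x v ∧ x ≠ u}
      (hG.exists_notMem (by rw [Set.ncard_pair h.ne]; norm_num)) (by
        intro w hw
        simp only [mem_insert_iff, mem_singleton_iff, not_or] at hw
        obtain ⟨z, hz⟩ := hG.exists_notMem (T := {u, v, w})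
          (Set.ncard_eq_three.2 ⟨u, v, w, h.ne, Ne.symm hw.1, Ne.symm hw.2, rfl⟩).le
        simp only [mem_insert_iff, mem_singleton_iff, not_or] at hz
        -- `x` is the first step of a walk from `u` to `z` avoiding `v` and `w`. A path from `v` to
        -- `x` avoiding `u` and `w`, with `v` dropped, then starts at the required neighbour of `v`.
        obtain ⟨x, hux, hxv, hxw⟩ : ∃ x, G.Adj u x ∧ x ≠ v ∧ x ≠ w := by
          obtain ⟨k, hk⟩ := hG.exists_walk (T := {w, v}) (by rw [Set.ncard_pair hw.2]; norm_num)
            (a := u) (b := z) (by simp [Ne.symm hw.1, h.ne]) (by simp [hz])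
          cases k with
          | nil => exact absurd rfl hz.1
          | @cons _ x _ e k =>
            have := hk x (by simp)
            simp only [mem_insert_iff, mem_singleton_iff, not_or] at this
            exact ⟨x, e, this.2, this.1⟩
        obtain ⟨k, hk⟩ := hG.exists_walk (T := {w, u}) (by rw [Set.ncard_pair hw.1]; norm_num)
          (a := v) (b := x) (by simp [Ne.symm hw.2, h.ne']) (by simp [hxw, hux.ne'])
        have hk' : ∀ z ∈ k.bypass.support, z ∉ ({w, u} : Set V) :=
          fun z hz => hk z (k.support_bypass_subset_support hz)
        have hkp := k.bypass_isPath
        generalize k.bypass = k' at hk' hkp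
        cases k' with
        | nil => exact absurd rfl hxv
        | @cons _ y _ e k' =>
          rw [Walk.cons_isPath_iff] at hkp
          have hy := hk' y (by simp)
          simp only [mem_insert_iff, mem_singleton_iff, not_or] at hy
          refine ⟨x, ⟨hux, hxv⟩, y, ⟨e.symm, hy.2⟩, k'.reverse, ?_, ?_⟩
          · intro hmem
            rw [Walk.support_reverse, List.mem_reverse] at hmem
            exact hk' w (by simp [hmem]) (by simp)
          · intro z hz
            rw [Walk.support_reverse, List.mem_reverse] at hz
            have h1 := hk' z (by simp [hz])
            have h2 : z ≠ v := fun e => hkp.2 (e ▸ hz)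
            simp only [mem_insert_iff, mem_singleton_iff, not_or] at h1 ⊢
            exact ⟨h1.2, h2⟩)
  have hp' : ∀ z ∈ p.bypass.support, z ≠ u ∧ z ≠ v := fun z hz => by
    simpa using hp z (p.support_bypass_subset_support hz)
  have hq' : ∀ z ∈ q.bypass.support, z ≠ u ∧ z ≠ v := fun z hz => by
    simpa using hq z (q.support_bypass_subset_support hz)
  -- The third leg is the edge itself; the empty walk `.nil` is its part before the last step.
  refine ⟨_, _, _, Walk.isTheta_concat hb.1 hb'.1 h (p := .cons ha.1 p.bypass)
    (q := .cons ha'.1 q.bypass) (r := .nil)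
    ((Walk.cons_isPath_iff _ _).2 ⟨p.bypass_isPath, fun h => (hp' u h).1 rfl⟩)
    ((Walk.cons_isPath_iff _ _).2 ⟨q.bypass_isPath, fun h => (hq' u h).1 rfl⟩) Walk.IsPath.nil
    ?_ ?_ (by simpa using h.ne') ?_ (by simp) (by simp) ?_ hb.2 hb'.2⟩
  · rw [Walk.support_cons, List.mem_cons, not_or]
    exact ⟨h.ne', fun h => (hp' v h).2 rfl⟩
  · rw [Walk.support_cons, List.mem_cons, not_or]
    exact ⟨h.ne', fun h => (hq' v h).2 rfl⟩
  · intro z hz hz'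
    rw [Walk.support_cons, List.mem_cons] at hz hz'
    rcases hz with rfl | hz
    · rfl
    · rcases hz' with rfl | hz'
      · rfl
      · exact absurd (q.support_bypass_subset_support hz')
          (hpq z (p.support_bypass_subset_support hz))
  · rintro rfl
    exact hpq _ p.end_mem_support q.end_mem_support

theorem Walk.IsTheta.isTripod_left {u v : V} {p q r : G.Walk u v} (h : Walk.IsTheta p q r) :
    G.IsTripod u p.snd q.snd r.snd where
  adj₁ := Walk.adj_snd (Walk.not_nil_of_ne h.ne)
  adj₂ := Walk.adj_snd (Walk.not_nil_of_ne h.ne)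
  adj₃ := Walk.adj_snd (Walk.not_nil_of_ne h.ne)
  ne₁₂ := h.disjoint₁₂.2
  ne₁₃ := h.disjoint₁₃.2
  ne₂₃ := h.disjoint₂₃.2

theorem Walk.InternallyDisjoint.penultimate_ne {u v : V} {p q : G.Walk u v} (huv : u ≠ v)
    (hp : p.IsPath) (hq : q.IsPath) (h : p.InternallyDisjoint q) :
    p.penultimate ≠ q.penultimate := by
  intro e
  exact h.disjoint_edges hp hq (p.mk_penultimate_end_mem_edges (Walk.not_nil_of_ne huv))
    (e ▸ q.mk_penultimate_end_mem_edges (Walk.not_nil_of_ne huv))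

theorem Walk.IsTheta.isTripod_right {u v : V} {p q r : G.Walk u v} (h : Walk.IsTheta p q r) :
    G.IsTripod v p.penultimate q.penultimate r.penultimate where
  adj₁ := (Walk.adj_penultimate (Walk.not_nil_of_ne h.ne)).symm
  adj₂ := (Walk.adj_penultimate (Walk.not_nil_of_ne h.ne)).symm
  adj₃ := (Walk.adj_penultimate (Walk.not_nil_of_ne h.ne)).symm
  ne₁₂ := h.disjoint₁₂.penultimate_ne h.ne h.isPath₁ h.isPath₂
  ne₁₃ := h.disjoint₁₃.penultimate_ne h.ne h.isPath₁ h.isPath₃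
  ne₂₃ := h.disjoint₂₃.penultimate_ne h.ne h.isPath₂ h.isPath₃

/-- In a `3`-connected graph a theta-invariant property holds for all tripods or for none. -/
theorem IsThetaInvariant.iff_of_isTripod {Q : V → V → V → V → Prop} (hQ : G.IsThetaInvariant Q)
    (hG : G.IsVertexConnected 3) {v a b c v' a' b' c' : V} (h : G.IsTripod v a b c)
    (h' : G.IsTripod v' a' b' c') : Q v a b c ↔ Q v' a' b' c' := by
  obtain ⟨p, -⟩ := hG.exists_walk (T := ∅) (by simp) (notMem_empty v) (notMem_empty v')
  induction p generalizing a b c with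
  | nil => exact hQ.iff_of_same_center hG h h'
  | cons e p ih =>
    obtain ⟨q, r, s, hT⟩ := hG.exists_isTheta e
    rw [hQ.iff_of_same_center hG h hT.isTripod_left, hQ.theta hT]
    exact ih hT.isTripod_right h'

end SimpleGraph

/-! ### Uniqueness of the induced orders up to reflection -/

open SimpleGraph in
theorem SphereEmbedding.inducedOrder_iff_or {V : Type*} {G : SimpleGraph V}
    (hG : G.IsVertexConnected 3) (em em₀ : SphereEmbedding G) :
    (∀ v a b c, em.InducedOrder v a b c ↔ em₀.InducedOrder v a b c) ∨
      ∀ v a b c, em.InducedOrder v a b c ↔ em₀.mirror.InducedOrder v a b c := by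
  set I : SphereEmbedding G → V → V → V → V → Prop := fun em v a b c =>
    ∃ (ha : G.Adj v a) (hb : G.Adj v b) (hc : G.Adj v c),
      em.InducedOrder v ⟨a, ha⟩ ⟨b, hb⟩ ⟨c, hc⟩ with hI
  have rot : ∀ {em : SphereEmbedding G} {v a b c}, I em v a b c → I em v b c a :=
    fun ⟨ha, hb, hc, h⟩ => ⟨hb, hc, ha, h.rotate⟩
  have excl : ∀ {em : SphereEmbedding G} {v a b c}, I em v a b c → ¬ I em v a c b :=
    fun ⟨_, _, _, h⟩ ⟨_, _, _, h'⟩ => h.not_swap h'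
  have theta : ∀ (em : SphereEmbedding G) {v u : V} {p q r : G.Walk v u}, Walk.IsTheta p q r →
      (I em v p.snd q.snd r.snd ∧ I em u p.penultimate r.penultimate q.penultimate) ∨
      (I em v p.snd r.snd q.snd ∧ I em u p.penultimate q.penultimate r.penultimate) := by
    intro em v u p q r hT
    have h1 := hT.isTripod_left
    have h2 := hT.isTripod_right
    rcases em.inducedOrder_theta hT (a := ⟨_, h1.adj₁⟩) (b := ⟨_, h1.adj₂⟩) (c := ⟨_, h1.adj₃⟩)
      (a' := ⟨_, h2.adj₁⟩) (b' := ⟨_, h2.adj₂⟩) (c' := ⟨_, h2.adj₃⟩) rfl rfl rfl rfl rfl rfl with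
      ⟨k1, k2⟩ | ⟨k1, k2⟩
    · exact Or.inl ⟨⟨_, _, _, k1⟩, ⟨_, _, _, k2⟩⟩
    · exact Or.inr ⟨⟨_, _, _, k1⟩, ⟨_, _, _, k2⟩⟩
  -- That wild arcs have an eventually constant order on small circles is not automatic. It holds at
  -- the ends of a theta, hence, by invariance, for every tripod.
  have inv₁ : ∀ em, G.IsThetaInvariant fun v a b c => I em v a b c ∨ I em v a c b := by
    intro em
    refine ⟨?_, ?_, ?_⟩
    · rintro v a b c (h | h)
      · exact Or.inr (rot h)
      · exact Or.inl (rot (rot h))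
    · rintro v a b c (h | h)
      · exact Or.inl (rot h)
      · exact Or.inr (rot (rot h))
    · intro v u p q r hT
      rcases theta em hT with ⟨h1, h2⟩ | ⟨h1, h2⟩ <;> simp [h1, h2]
  -- Both embeddings reverse the order along a theta, so agreement at one branch point is agreement
  -- at the other. Both orientations appear so that the property is symmetric in the legs.
  have inv₂ : G.IsThetaInvariant fun v a b c =>
      (I em v a b c ↔ I em₀ v a b c) ∧ (I em v a c b ↔ I em₀ v a c b) := by
    have rot' : ∀ (em : SphereEmbedding G) {v a b c}, I em v a b c ↔ I em v b c a :=
      fun _ => ⟨rot, fun h => rot (rot h)⟩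
    refine ⟨?_, ?_, ?_⟩
    · rintro v a b c ⟨h1, h2⟩
      exact ⟨(rot' em).trans (h2.trans (rot' em₀).symm),
        (rot' em).symm.trans (h1.trans (rot' em₀))⟩
    · rintro v a b c ⟨h1, h2⟩
      exact ⟨(rot' em).symm.trans (h1.trans (rot' em₀)),
        (rot' em).trans (h2.trans (rot' em₀).symm)⟩
    · intro v u p q r hT
      rcases theta em hT with ⟨h1, h2⟩ | ⟨h1, h2⟩ <;>
        rcases theta em₀ hT with ⟨h3, h4⟩ | ⟨h3, h4⟩ <;>
        simp [h1, h2, h3, h4, excl h1, excl h2, excl h3, excl h4]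
  have dich : ∀ (em : SphereEmbedding G) {v a b c}, G.IsTripod v a b c →
      I em v a b c ∨ I em v a c b := by
    intro em v a b c h
    obtain ⟨p, q, r, hT⟩ := hG.exists_isTheta h.adj₁
    refine ((inv₁ em).iff_of_isTripod hG h hT.isTripod_left).2 ?_
    rcases theta em hT with ⟨h1, -⟩ | ⟨h1, -⟩
    · exact Or.inl h1
    · exact Or.inr h1
  have tri : ∀ {em : SphereEmbedding G} {v} {a b c : G.neighborSet v}, em.InducedOrder v a b c →
      G.IsTripod v a b c := fun {em v a b c} h =>
    ⟨a.2, b.2, c.2, fun e => h.ne.1 (Subtype.ext e), fun e => h.ne.2.2 (Subtype.ext e),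
      fun e => h.ne.2.1 (Subtype.ext e)⟩
  have toI : ∀ {em : SphereEmbedding G} {v} {a b c : G.neighborSet v},
      em.InducedOrder v a b c ↔ I em v a b c :=
    fun {em v a b c} => ⟨fun h => ⟨a.2, b.2, c.2, h⟩, fun ⟨_, _, _, h⟩ => h⟩
  have triI : ∀ {em : SphereEmbedding G} {v a b c}, I em v a b c → G.IsTripod v a b c :=
    fun ⟨_, _, _, h⟩ => tri h
  by_cases hall : ∀ v a b c, G.IsTripod v a b c → (I em v a b c ↔ I em₀ v a b c)
  · left
    intro v a b c
    rw [toI, toI]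
    exact ⟨fun h => (hall _ _ _ _ (triI h)).1 h, fun h => (hall _ _ _ _ (triI h)).2 h⟩
  · right
    push Not at hall
    obtain ⟨v₀, a₀, b₀, c₀, h₀, hne⟩ := hall
    have hnone : ∀ {v a b c}, G.IsTripod v a b c → ¬ ((I em v a b c ↔ I em₀ v a b c) ∧
        (I em v a c b ↔ I em₀ v a c b)) := by
      intro v a b c h hh
      have := ((inv₂.iff_of_isTripod hG h h₀).1 hh).1
      rcases hne with hne | hne
      · exact hne.2 (this.1 hne.1)
      · exact hne.1 (this.2 hne.2)
    -- A tripod has exactly one of two orders in each embedding, so disagreement means that they are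
    -- opposite.
    have hopp : ∀ {v a b c}, G.IsTripod v a b c → (I em v a b c ↔ I em₀ v a c b) := by
      intro v a b c h
      have h1 := hnone h
      revert h1
      rcases dich em h with h2 | h2 <;> rcases dich em₀ h with h3 | h3 <;>
        simp [h2, h3, excl h2, excl h3]
    intro v a b c
    rw [SphereEmbedding.inducedOrder_mirror, toI, toI]
    refine ⟨fun h => (hopp (triI h)).1 h, fun h => (hopp ?_).2 h⟩
    have := triI h
    exact ⟨this.adj₁, this.adj₃, this.adj₂, this.ne₁₃, this.ne₁₂, this.ne₂₃.symm⟩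

theorem mainTheorem9 {V : Type*} (G : SimpleGraph V) (hG : G.IsVertexConnected 3)
    (R : RibbonStructure G) (em₀ : SphereEmbedding G) :
    IsLeast (Set.range fun em : SphereEmbedding G => R.defect em)
      (min (R.defect em₀) (R.defect em₀.mirror)) := by
  have congr : ∀ {em em' : SphereEmbedding G},
      (∀ v a b c, em.InducedOrder v a b c ↔ em'.InducedOrder v a b c) →
      R.defect em = R.defect em' := by
    intro em em' h
    simp only [RibbonStructure.defect, RibbonStructure.AgreesAt, h]
  constructor
  · rcases min_choice (R.defect em₀) (R.defect em₀.mirror) with h | h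
    · exact ⟨em₀, h.symm⟩
    · exact ⟨em₀.mirror, h.symm⟩
  · rintro _ ⟨em, rfl⟩
    rcases em.inducedOrder_iff_or hG em₀ with h | h
    · exact (min_le_left _ _).trans (congr h).ge
    · exact (min_le_right _ _).trans (congr h).ge
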